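/- Let $R$ be an associative ring with unit and let $M$ be a right $R$-module. An $\mathcal R$-module (resp. right $\mathcal R$-module) is a covariant additive functor from the category of left (resp. right) $R$-modules to the category of abelian groups; kernels, cokernels, products and direct sums of such functors are computed pointwise. The quasi-coherent $\mathcal R$-module associated with a right $R$-module $N$ is $\mathcal N(S)=N\otimes_R S$, and the quasi-coherent right $\mathcal R$-module associated with a left $R$-module $N$ is $\mathcal N(T)=T\otimes_R N$; for $N=R$ both are denoted by $\mathcal R$. The dual of an $\mathcal R$-module $\mathbb M$ is the right $\mathcal R$-module $\mathbb M^*$ given by $\mathbb M^*(N)=\operatorname{Hom}_{\mathcal R}(\mathbb M,\mathcal N)$ (natural transformations) for every right $R$-module $N$. An $\mathcal R$-module $\mathbb M$ preserves direct products if the natural map $\mathbb M(\prod_{i\in I}S_i)\to\prod_{i\in I}\mathbb M(S_i)$ is an isomorphism for every family $(S_i)_{i\in I}$ of left $R$-modules. $M$ is Mittag-Leffler if for every finitely presented right $R$-module $P$ and every homomorphism $f\colon P\to M$ there are a finitely presented right $R$-module $Q$ and a homomorphism $g\colon P\to Q$ such that $\ker(f\otimes_R S)=\ker(g\otimes_R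 S)$ for every left $R$-module $S$. $M$ is strict Mittag-Leffler if for every finitely generated submodule $i\colon N\hookrightarrow M$ there are a finitely presented right $R$-module $P$ and homomorphisms $f\colon M\to P$, $g\colon P\to M$ with $g\circ f\circ i=i$. Theorem. (1) $M$ is a Mittag-Leffler module if and only if the kernel of every morphism of $\mathcal R$-modules $\prod_{\mathbb N}\mathcal R\to\mathcal M$ preserves direct products. (2) $M$ is a strict Mittag-Leffler module if and only if the cokernel of every morphism of right $\mathcal R$-modules $\mathcal M^*\to\bigoplus_{\mathbb N}\mathcal R$ is isomorphic to an $\mathcal R$-submodule of a quasi-coherent right $\mathcal R$-module. -/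

import Mathlib

open CategoryTheory CategoryTheory.Limits MulOpposite
open scoped TensorProduct

universe u

namespace FunctorialModules

noncomputable section

/-! Throughout, `R` is an arbitrary (associative, unital) ring, left `R`-modules are objects of
`ModuleCat.{u} R` and right `R`-modules are objects of `ModuleCat.{u} Rᵐᵒᵖ`, the right action being
`m * r = op r • m`. -/

/-! ### The tensor product over a noncommutative ring -/

section BalancedTensor

variable (R : Type u) [Ring R]

/-- The subgroup of `M ⊗[ℤ] S` generated by the elements `(m * r) ⊗ s - m ⊗ (r * s)`. -/
def balancingSubgroup (M S : Type u) [AddCommGroup M] [Module Rᵐᵒᵖ M] [AddCommGroup S]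
    [Module R S] : AddSubgroup (M ⊗[ℤ] S) :=
  AddSubgroup.closure
    {x | ∃ (m : M) (r : R) (s : S), x = (op r • m) ⊗ₜ[ℤ] s - m ⊗ₜ[ℤ] (r • s)}

/-- The abelian group `M ⊗_R S`, for a right `R`-module `M` and a left `R`-module `S`. -/
abbrev BalancedTensor (M S : Type u) [AddCommGroup M] [Module Rᵐᵒᵖ M] [AddCommGroup S]
    [Module R S] : Type u :=
  (M ⊗[ℤ] S) ⧸ balancingSubgroup R M S

variable {M M' M'' S S' S'' : Type u}
  [AddCommGroup M] [Module Rᵐᵒᵖ M] [AddCommGroup M'] [Module Rᵐᵒᵖ M']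
  [AddCommGroup M''] [Module Rᵐᵒᵖ M'']
  [AddCommGroup S] [Module R S] [AddCommGroup S'] [Module R S'] [AddCommGroup S''] [Module R S'']

/-- The pure tensor `m ⊗ s` in `M ⊗_R S`. -/
def BalancedTensor.tmul (m : M) (s : S) : BalancedTensor R M S :=
  QuotientAddGroup.mk (m ⊗ₜ[ℤ] s)

variable {R}

/-- The homomorphism `f ⊗ g : M ⊗_R S → M' ⊗_R S'`, which sends `m ⊗ s` to `f m ⊗ g s`. -/
def BalancedTensor.map (f : M →ₗ[Rᵐᵒᵖ] M') (g : S →ₗ[R] S') :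
    BalancedTensor R M S →+ BalancedTensor R M' S' :=
  QuotientAddGroup.map _ _
    (TensorProduct.map f.toAddMonoidHom.toIntLinearMap
      g.toAddMonoidHom.toIntLinearMap).toAddMonoidHom
    (by
      refine (AddSubgroup.closure_le _).2 ?_
      rintro _ ⟨m, r, s, rfl⟩
      refine AddSubgroup.subset_closure ⟨f m, r, g s, ?_⟩
      simp)

@[simp]
theorem BalancedTensor.map_tmul (f : M →ₗ[Rᵐᵒᵖ] M') (g : S →ₗ[R] S') (m : M) (s : S) :
    BalancedTensor.map f g (BalancedTensor.tmul R m s) = BalancedTensor.tmul R (f m) (g s) :=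
  rfl

theorem BalancedTensor.hom_ext {A : Type*} [AddCommGroup A] {φ ψ : BalancedTensor R M S →+ A}
    (h : ∀ m s, φ (BalancedTensor.tmul R m s) = ψ (BalancedTensor.tmul R m s)) : φ = ψ := by
  refine QuotientAddGroup.addMonoidHom_ext _ (AddMonoidHom.ext fun x => ?_)
  induction x using TensorProduct.induction_on with
  | zero => simp
  | tmul m s => exact h m s
  | add x y hx hy => rw [map_add, map_add, hx, hy]

theorem BalancedTensor.add_tmul (m m' : M) (s : S) :
    BalancedTensor.tmul R (m + m') s = BalancedTensor.tmul R m s + BalancedTensor.tmul R m' s :=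
  congrArg QuotientAddGroup.mk (TensorProduct.add_tmul m m' s)

theorem BalancedTensor.tmul_add (m : M) (s s' : S) :
    BalancedTensor.tmul R m (s + s') = BalancedTensor.tmul R m s + BalancedTensor.tmul R m s' :=
  congrArg QuotientAddGroup.mk (TensorProduct.tmul_add m s s')

theorem BalancedTensor.map_id :
    BalancedTensor.map (LinearMap.id : M →ₗ[Rᵐᵒᵖ] M) (LinearMap.id : S →ₗ[R] S) =
      AddMonoidHom.id _ :=
  BalancedTensor.hom_ext fun _ _ => rfl

theorem BalancedTensor.map_comp (f' : M' →ₗ[Rᵐᵒᵖ] M'') (f : M →ₗ[Rᵐᵒᵖ] M')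
    (g' : S' →ₗ[R] S'') (g : S →ₗ[R] S') :
    BalancedTensor.map (f' ∘ₗ f) (g' ∘ₗ g) =
      (BalancedTensor.map f' g').comp (BalancedTensor.map f g) :=
  BalancedTensor.hom_ext fun _ _ => rfl

end BalancedTensor

/-! ### Functors of modules -/

variable (R : Type u) [Ring R]

/-- The category of functors from left `R`-modules to abelian groups. The modules are those of the
universe `u`; the abelian groups are taken one universe higher, so that the group of all morphisms
between two such functors is again a possible value of such a functor. The `𝓡`-modules are the
additive functors; kernels, cokernels, products and direct sums of these are computed pointwise. -/
abbrev FunctorOfModules : Type (u + 2) :=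
  ModuleCat.{u} R ⥤ AddCommGrpCat.{u + 1}

/-- The bifunctor `(M, S) ↦ M ⊗_R S`, for `M` a right and `S` a left `R`-module. -/
def tensorBifunctor : ModuleCat.{u} Rᵐᵒᵖ ⥤ ModuleCat.{u} R ⥤ AddCommGrpCat.{u + 1} where
  obj M :=
    { obj := fun S => AddCommGrpCat.of (ULift.{u + 1} (BalancedTensor R M S))
      map := fun g => AddCommGrpCat.ofHom
        ((AddEquiv.ulift.symm.toAddMonoidHom.comp (BalancedTensor.map LinearMap.id g.hom)).comp
          AddEquiv.ulift.toAddMonoidHom)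
      map_id := fun S => by
        ext ⟨x⟩
        exact (DFunLike.congr_fun BalancedTensor.map_id x)
      map_comp := fun g g' => by
        ext ⟨x⟩
        exact 
          (DFunLike.congr_fun (BalancedTensor.map_comp LinearMap.id LinearMap.id g'.hom g.hom) x) }
  map f :=
    { app := fun S => AddCommGrpCat.ofHom
        ((AddEquiv.ulift.symm.toAddMonoidHom.comp (BalancedTensor.map f.hom LinearMap.id)).comp
          AddEquiv.ulift.toAddMonoidHom)
      naturality := fun S S' g => by
        ext ⟨x⟩
        exact (
          (DFunLike.congr_fun (BalancedTensor.map_comp f.hom LinearMap.id LinearMap.id g.hom)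
            x).symm.trans
          (DFunLike.congr_fun (BalancedTensor.map_comp LinearMap.id f.hom g.hom LinearMap.id) x)) }
  map_id M := by
    ext S ⟨x⟩
    exact (DFunLike.congr_fun BalancedTensor.map_id x)
  map_comp f f' := by
    ext S ⟨x⟩
    exact 
      (DFunLike.congr_fun (BalancedTensor.map_comp f'.hom f.hom LinearMap.id LinearMap.id) x)

variable {R}

/-- The quasi-coherent `𝓡`-module `S ↦ M ⊗_R S` associated with a right `R`-module `M`. -/
abbrev quasiCoherent (M : ModuleCat.{u} Rᵐᵒᵖ) : FunctorOfModules R :=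
  (tensorBifunctor R).obj M

/-- The quasi-coherent right `𝓡`-module `T ↦ T ⊗_R N` associated with a left `R`-module `N`. -/
abbrev quasiCoherentRight (N : ModuleCat.{u} R) : FunctorOfModules Rᵐᵒᵖ :=
  (tensorBifunctor R).flip.obj N

/-- The dual `N ↦ Hom_𝓡(𝕄, 𝓝)` of an `𝓡`-module `𝕄`, a functor on right `R`-modules `N`; here
`𝓝` is the quasi-coherent module `S ↦ N ⊗_R S` and `Hom_𝓡` is the group of all natural
transformations. -/
def dual (𝕄 : FunctorOfModules R) : FunctorOfModules Rᵐᵒᵖ :=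
  tensorBifunctor R ⋙ preadditiveCoyoneda.obj (Opposite.op 𝕄)

theorem BalancedTensor.map_add_right (M S S' : Type u) [AddCommGroup M] [Module Rᵐᵒᵖ M]
    [AddCommGroup S] [Module R S] [AddCommGroup S'] [Module R S'] (g g' : S →ₗ[R] S') :
    BalancedTensor.map (LinearMap.id : M →ₗ[Rᵐᵒᵖ] M) (g + g') =
      BalancedTensor.map LinearMap.id g + BalancedTensor.map LinearMap.id g' :=
  BalancedTensor.hom_ext fun m s => BalancedTensor.tmul_add m (g s) (g' s)

theorem BalancedTensor.map_add_left (M M' S : Type u) [AddCommGroup M] [Module Rᵐᵒᵖ M]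
    [AddCommGroup M'] [Module Rᵐᵒᵖ M'] [AddCommGroup S] [Module R S] (f f' : M →ₗ[Rᵐᵒᵖ] M') :
    BalancedTensor.map (f + f') (LinearMap.id : S →ₗ[R] S) =
      BalancedTensor.map f LinearMap.id + BalancedTensor.map f' LinearMap.id :=
  BalancedTensor.hom_ext fun m s => BalancedTensor.add_tmul (f m) (f' m) s

instance quasiCoherent_additive (M : ModuleCat.{u} Rᵐᵒᵖ) : (quasiCoherent M).Additive where
  map_add {_ _ g g'} := by
    ext ⟨x⟩
    exact congrArg ULift.up
      (DFunLike.congr_fun (BalancedTensor.map_add_right M _ _ g.hom g'.hom) x)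

instance tensorBifunctor_additive : (tensorBifunctor R).Additive where
  map_add {_ _ f f'} := by
    ext S ⟨x⟩
    exact congrArg ULift.up
      (DFunLike.congr_fun (BalancedTensor.map_add_left _ _ S f.hom f'.hom) x)

instance quasiCoherentRight_additive (N : ModuleCat.{u} R) :
    (quasiCoherentRight N).Additive where
  map_add {_ _ f f'} :=
    congrArg (fun η => NatTrans.app η N) ((tensorBifunctor R).map_add (f := f) (g := f'))

instance dual_additive (𝕄 : FunctorOfModules R) : (dual 𝕄).Additive :=
  inferInstanceAs (tensorBifunctor R ⋙ preadditiveCoyoneda.obj (Opposite.op 𝕄)).Additive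

/-- `𝕄` preserves direct products: the natural map `𝕄(∏ᵢ Sᵢ) → ∏ᵢ 𝕄(Sᵢ)` is an isomorphism for
every family `(Sᵢ)` of modules indexed by a set. -/
def PreservesDirectProducts (𝕄 : FunctorOfModules R) : Prop :=
  ∀ I : Type u, PreservesLimitsOfShape (Discrete I) 𝕄

/-! ### Mittag-Leffler and strict Mittag-Leffler modules -/

/-- A right `R`-module `M` is a Mittag-Leffler module if for every finitely presented right
`R`-module `P` and every homomorphism `f : P → M` there are a finitely presented right `R`-module
`Q` and a homomorphism `g : P → Q` such that `f` and `g` dominate each other: for every left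
`R`-module `S` the maps `f ⊗ S : P ⊗_R S → M ⊗_R S` and `g ⊗ S : P ⊗_R S → Q ⊗_R S` have
the same kernel. -/
def IsMittagLeffler (M : ModuleCat.{u} Rᵐᵒᵖ) : Prop :=
  ∀ (P : ModuleCat.{u} Rᵐᵒᵖ), Module.FinitePresentation Rᵐᵒᵖ P → ∀ f : P →ₗ[Rᵐᵒᵖ] M,
    ∃ Q : ModuleCat.{u} Rᵐᵒᵖ, Module.FinitePresentation Rᵐᵒᵖ Q ∧ ∃ g : P →ₗ[Rᵐᵒᵖ] Q,
      ∀ S : ModuleCat.{u} R,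
        (BalancedTensor.map f (LinearMap.id : S →ₗ[R] S)).ker =
          (BalancedTensor.map g (LinearMap.id : S →ₗ[R] S)).ker

/-- A right `R`-module `M` is a strict Mittag-Leffler module if for every finitely generated
submodule `N` of `M` there are a finitely presented module `P` and homomorphisms `f : M → P` and
`g : P → M` such that `g ∘ f` is the identity on `N`. -/
def IsStrictMittagLeffler (M : ModuleCat.{u} Rᵐᵒᵖ) : Prop :=
  ∀ N : Submodule Rᵐᵒᵖ M, N.FG →
    ∃ P : ModuleCat.{u} Rᵐᵒᵖ, Module.FinitePresentation Rᵐᵒᵖ P ∧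
      ∃ (f : M →ₗ[Rᵐᵒᵖ] P) (g : P →ₗ[Rᵐᵒᵖ] M), g ∘ₗ f ∘ₗ N.subtype = N.subtype

end

end FunctorialModules

/-! Both parts translate a condition on functors into elements of modules by Yoneda, and then
compare it with the definition through finitely presented approximations of `M`. (1) The functor
`∏_ℕ 𝓡` is `S ↦ S^ℕ`, represented by `R^(ℕ)`, so a morphism to `𝓜` is an element of `M ⊗ R^(ℕ) =
M^(ℕ)`: a finite tuple `m` acting by `s ↦ ∑ mᵢ ⊗ sᵢ`. Its kernel preserves products exactly when
such a sum over `∏ Tⱼ` vanishes once all its components do, so the condition for all `m` is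
`TensorSeparatesProducts`. (2) Here `𝓜^*(N) = Hom(M, N)` and `(⨁_ℕ 𝓡)(N) = N^(ℕ)`. A morphism
between them is again a tuple `m`, with image `{(φ mᵢ)}`, while a morphism `⨁_ℕ 𝓡 → 𝓦` is a sequence
`w`, with kernel `{n | ∑ nᵢ ⊗ wᵢ = 0}`. The cokernel embeds in `𝓦` when image and kernel agree,
which is `HomOrbitsAreAnnihilators`. Finitely presented modules have both properties, and these pass
to (strict) Mittag-Leffler modules. For the converses, a tensor that dies in `M ⊗ S` already dies at
a finitely presented stage: `exists_fg_map_mkQ_inl_eq_zero` and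
`exists_finitePresentation_under_quotient`. -/

namespace FunctorialModules

/-! ### Right exactness, direct products and finitely presented approximation for `⊗_R`. -/

section BalancedTensorLemmas

variable {R : Type u} [Ring R]
variable {M M' M'' S S' : Type u}
  [AddCommGroup M] [Module Rᵐᵒᵖ M] [AddCommGroup M'] [Module Rᵐᵒᵖ M']
  [AddCommGroup M''] [Module Rᵐᵒᵖ M'']
  [AddCommGroup S] [Module R S] [AddCommGroup S'] [Module R S']

namespace BalancedTensor

/-- The homomorphism out of `M ⊗_R S` given by a balanced biadditive map. -/
def lift {A : Type*} [AddCommGroup A] (φ : M →+ S →+ A)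
    (h : ∀ (m : M) (r : R) (s : S), φ (op r • m) s = φ m (r • s)) : BalancedTensor R M S →+ A :=
  QuotientAddGroup.lift _ (TensorProduct.liftAddHom (R := ℤ) φ fun n m s => by simp) (by
    refine (AddSubgroup.closure_le _).2 ?_
    rintro _ ⟨m, r, s, rfl⟩
    simp [h])

theorem smul_tmul (r : R) (m : M) (s : S) : tmul R (op r • m) s = tmul R m (r • s) :=
  (QuotientAddGroup.eq_iff_sub_mem).2 (AddSubgroup.subset_closure ⟨m, r, s, rfl⟩)

/-- The pure tensors as a biadditive map. -/
def mk : M →+ S →+ BalancedTensor R M S :=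
  AddMonoidHom.mk' (fun m => AddMonoidHom.mk' (fun s => tmul R m s) fun s s' => tmul_add m s s')
    fun m m' => AddMonoidHom.ext fun s => add_tmul m m' s

@[simp]
theorem mk_apply (m : M) (s : S) : mk m s = tmul R m s :=
  rfl

theorem zero_tmul (s : S) : tmul R (0 : M) s = 0 :=
  DFunLike.congr_fun (map_zero (mk (R := R) (M := M))) s

theorem tmul_zero (m : M) : tmul R m (0 : S) = 0 :=
  map_zero (mk (R := R) m)

theorem sub_tmul (m m' : M) (s : S) : tmul R (m - m') s = tmul R m s - tmul R m' s :=
  DFunLike.congr_fun (map_sub (mk (R := R) (M := M)) m m') s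

theorem sum_tmul {ι : Type*} (t : Finset ι) (m : ι → M) (s : S) :
    tmul R (∑ i ∈ t, m i) s = ∑ i ∈ t, tmul R (m i) s := by
  have := DFunLike.congr_fun (map_sum (mk (R := R) (M := M) (S := S)) m t) s
  rwa [AddMonoidHom.finsetSum_apply] at this

theorem induction {p : BalancedTensor R M S → Prop} (x : BalancedTensor R M S)
    (tmul : ∀ m s, p (tmul R m s)) (zero : p 0) (add : ∀ x y, p x → p y → p (x + y)) : p x := by
  induction x using QuotientAddGroup.induction_on with
  | H x =>
    induction x using TensorProduct.induction_on with
    | zero => exact zero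
    | tmul m s => exact tmul m s
    | add x y hx hy => exact add _ _ hx hy

theorem map_comp_left_apply (f' : M' →ₗ[Rᵐᵒᵖ] M'') (f : M →ₗ[Rᵐᵒᵖ] M')
    (x : BalancedTensor R M S) :
    map (f' ∘ₗ f) (LinearMap.id : S →ₗ[R] S) x =
      map f' LinearMap.id (map f (LinearMap.id : S →ₗ[R] S) x) :=
  DFunLike.congr_fun (map_comp f' f LinearMap.id LinearMap.id) x

theorem map_map_comm (f : M →ₗ[Rᵐᵒᵖ] M') (g : S →ₗ[R] S') (x : BalancedTensor R M S) :
    map f (LinearMap.id : S' →ₗ[R] S') (map LinearMap.id g x) =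
      map LinearMap.id g (map f LinearMap.id x) := by
  rw [← AddMonoidHom.comp_apply, ← AddMonoidHom.comp_apply, ← map_comp, ← map_comp]
  rfl

theorem map_surjective {f : M →ₗ[Rᵐᵒᵖ] M'} (hf : Function.Surjective f) :
    Function.Surjective (map f (LinearMap.id : S →ₗ[R] S)) := fun x => by
  induction x using induction with
  | tmul m s =>
    obtain ⟨m, rfl⟩ := hf m
    exact ⟨tmul R m s, map_tmul _ _ _ _⟩
  | zero => exact ⟨0, map_zero _⟩
  | add x y hx hy =>
    obtain ⟨x, rfl⟩ := hx
    obtain ⟨y, rfl⟩ := hy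
    exact ⟨x + y, map_add _ _ _⟩

/-- Right exactness of the tensor product. -/
theorem mem_closure_of_map_eq_zero {p : M →ₗ[Rᵐᵒᵖ] M'} (hp : Function.Surjective p)
    {x : BalancedTensor R M S} (hx : map p (LinearMap.id : S →ₗ[R] S) x = 0) :
    x ∈ AddSubgroup.closure {y | ∃ k ∈ LinearMap.ker p, ∃ s : S, y = tmul R k s} := by
  set I := AddSubgroup.closure {y | ∃ k ∈ LinearMap.ker p, ∃ s : S, y = tmul R k s}
  -- A set-theoretic section suffices: it is additive and linear up to `ker p`, hence exactly so
  -- after tensoring and dividing by `I`. This inverts `p ⊗ S` modulo `I`.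
  obtain ⟨σ, hσ⟩ := hp.hasRightInverse
  have key : ∀ (a b : M) (s : S), p a = p b →
      (QuotientAddGroup.mk (tmul R a s) : BalancedTensor R M S ⧸ I) =
        QuotientAddGroup.mk (tmul R b s) := fun a b s hab => by
    refine (QuotientAddGroup.eq_iff_sub_mem).2 (AddSubgroup.subset_closure ⟨a - b, ?_, s, ?_⟩)
    · simp [hab]
    · rw [sub_tmul]
  let φ : M' →+ S →+ BalancedTensor R M S ⧸ I :=
    AddMonoidHom.mk' (fun m => (QuotientAddGroup.mk' I).comp (mk (R := R) (σ m))) fun m m' => by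
      ext s
      simp only [AddMonoidHom.comp_apply, AddMonoidHom.add_apply, mk_apply]
      rw [← map_add, ← add_tmul]
      exact key _ _ _ (by rw [map_add, hσ, hσ, hσ])
  let ψ : BalancedTensor R M' S →+ BalancedTensor R M S ⧸ I := lift φ fun m r s => by
    change QuotientAddGroup.mk (tmul R _ _) = QuotientAddGroup.mk (tmul R _ _)
    rw [← smul_tmul]
    exact key _ _ _ (by rw [map_smul, hσ, hσ])
  have hψ : ψ.comp (map p (LinearMap.id : S →ₗ[R] S)) = QuotientAddGroup.mk' I :=
    hom_ext fun m s => key _ _ _ (hσ (p m))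
  have := DFunLike.congr_fun hψ x
  rw [AddMonoidHom.comp_apply, hx, map_zero] at this
  exact (QuotientAddGroup.eq_zero_iff x).1 this.symm

theorem mem_range_of_map_eq_zero {a : M →ₗ[Rᵐᵒᵖ] M'} {p : M' →ₗ[Rᵐᵒᵖ] M''}
    (hp : Function.Surjective p) (hap : LinearMap.ker p ≤ LinearMap.range a)
    {x : BalancedTensor R M' S} (hx : map p (LinearMap.id : S →ₗ[R] S) x = 0) :
    x ∈ (map a (LinearMap.id : S →ₗ[R] S)).range := by
  refine (AddSubgroup.closure_le _).2 ?_ (mem_closure_of_map_eq_zero hp hx)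
  rintro _ ⟨k, hk, s, rfl⟩
  obtain ⟨l, rfl⟩ := hap hk
  exact ⟨tmul R l s, rfl⟩

/-- A tensor that vanishes in a quotient already vanishes in the quotient by a finitely generated
submodule of the kernel. -/
theorem exists_fg_map_mkQ_eq_zero {p : M →ₗ[Rᵐᵒᵖ] M'} (hp : Function.Surjective p)
    {x : BalancedTensor R M S} (hx : map p (LinearMap.id : S →ₗ[R] S) x = 0) :
    ∃ N : Submodule Rᵐᵒᵖ M, N.FG ∧ N ≤ LinearMap.ker p ∧
      map N.mkQ (LinearMap.id : S →ₗ[R] S) x = 0 := by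
  have mono : ∀ (N N' : Submodule Rᵐᵒᵖ M), N ≤ N' → ∀ y : BalancedTensor R M S,
      map N.mkQ (LinearMap.id : S →ₗ[R] S) y = 0 →
      map N'.mkQ (LinearMap.id : S →ₗ[R] S) y = 0 := fun N N' h y hy => by
    have : N'.mkQ = Submodule.factor h ∘ₗ N.mkQ := rfl
    rw [this, map_comp_left_apply, hy, map_zero]
  replace hx := mem_closure_of_map_eq_zero hp hx
  induction hx using AddSubgroup.closure_induction with
  | mem y hy =>
    obtain ⟨k, hk, s, rfl⟩ := hy
    refine ⟨Submodule.span _ {k}, Submodule.fg_span_singleton k,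
      (Submodule.span_singleton_le_iff_mem _ _).2 hk, ?_⟩
    rw [map_tmul, Submodule.mkQ_apply,
      (Submodule.Quotient.mk_eq_zero _).2 (Submodule.mem_span_singleton_self k), zero_tmul]
  | zero => exact ⟨⊥, Submodule.fg_bot, bot_le, map_zero _⟩
  | add y z _ _ hy hz =>
    obtain ⟨N, hN, hNp, hy⟩ := hy
    obtain ⟨N', hN', hNp', hz⟩ := hz
    refine ⟨N ⊔ N', hN.sup hN', sup_le hNp hNp', ?_⟩
    rw [map_add, mono _ _ le_sup_left _ hy, mono _ _ le_sup_right _ hz, add_zero]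
  | neg y _ hy =>
    obtain ⟨N, hN, hNp, hy⟩ := hy
    exact ⟨N, hN, hNp, by rw [map_neg, hy, neg_zero]⟩

/-- The standard basis expansion of a tensor in `Rⁿ ⊗_R S`. -/
def ofPi {n : ℕ} (s : Fin n → S) : BalancedTensor R (Fin n → Rᵐᵒᵖ) S :=
  ∑ i, tmul R (Pi.single i 1) (s i)

/-- The coordinates of a tensor in `Rⁿ ⊗_R S`. -/
def toPi {n : ℕ} : BalancedTensor R (Fin n → Rᵐᵒᵖ) S →+ (Fin n → S) :=
  lift
    (AddMonoidHom.mk'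
      (fun c => AddMonoidHom.mk' (fun s i => unop (c i) • s) fun s s' => by ext; simp)
      fun c c' => by ext; simp [add_smul])
    fun c r s => by ext; simp [mul_smul]

theorem ofPi_toPi {n : ℕ} (x : BalancedTensor R (Fin n → Rᵐᵒᵖ) S) : ofPi (toPi x) = x := by
  induction x using induction with
  | tmul c s =>
    have : ∀ i, tmul R (Pi.single i 1 : Fin n → Rᵐᵒᵖ) (unop (c i) • s) =
        tmul R (Pi.single i (c i) : Fin n → Rᵐᵒᵖ) s :=
      fun i => by rw [← smul_tmul, ← Pi.single_smul]; simp
    change ∑ i, tmul R (Pi.single i 1 : Fin n → Rᵐᵒᵖ) (unop (c i) • s) = _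
    simp_rw [this]
    rw [← sum_tmul, Finset.univ_sum_single]
  | zero => simp [ofPi, tmul_zero]
  | add x y hx hy =>
    rw [map_add]
    nth_rw 2 [← hx, ← hy]
    simp [ofPi, tmul_add, Finset.sum_add_distrib]

theorem map_ofPi {n : ℕ} (f : (Fin n → Rᵐᵒᵖ) →ₗ[Rᵐᵒᵖ] M) (g : S →ₗ[R] S') (s : Fin n → S) :
    map f g (ofPi s) = ∑ i, tmul R (f (Pi.single i 1)) (g (s i)) := by
  simp [ofPi]

theorem map_id_ofPi {n : ℕ} (g : S →ₗ[R] S') (s : Fin n → S) :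
    map (LinearMap.id : (Fin n → Rᵐᵒᵖ) →ₗ[Rᵐᵒᵖ] _) g (ofPi s) = ofPi (g ∘ s) := by
  rw [map_ofPi]; rfl

section Products

variable {I : Type u} {T : I → Type u} [∀ j, AddCommGroup (T j)] [∀ j, Module R (T j)]

/-- Together with `pi_ext`, this says that tensoring with `Rⁿ` commutes with products, since `Rⁿ ⊗ S
= Sⁿ`. -/
theorem exists_pi_lift {n : ℕ} (z : ∀ j, BalancedTensor R (Fin n → Rᵐᵒᵖ) (T j)) :
    ∃ y : Fin n → ∀ j, T j,
      ∀ j, map LinearMap.id (LinearMap.proj j : (∀ j, T j) →ₗ[R] T j) (ofPi (R := R) y) = z j :=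
  ⟨fun i j => toPi (z j) i, fun j => by rw [map_id_ofPi]; exact ofPi_toPi (z j)⟩

theorem pi_ext {n : ℕ} {x y : BalancedTensor R (Fin n → Rᵐᵒᵖ) (∀ j, T j)}
    (h : ∀ j, map LinearMap.id (LinearMap.proj j : (∀ j, T j) →ₗ[R] T j) x =
      map LinearMap.id (LinearMap.proj j : (∀ j, T j) →ₗ[R] T j) y) : x = y := by
  have toPi_map : ∀ j (z : BalancedTensor R (Fin n → Rᵐᵒᵖ) (∀ j, T j)) (i : Fin n),
      toPi (map LinearMap.id (LinearMap.proj j : (∀ j, T j) →ₗ[R] T j) z) i = toPi z i j :=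
    fun j z i => by
      induction z using induction with
      | tmul c s => rfl
      | zero => simp
      | add x y hx hy => simp_all
  rw [← ofPi_toPi x, ← ofPi_toPi y]
  congr 1
  ext i j
  rw [← toPi_map, ← toPi_map, h]

/-- Tensoring a finitely presented module with a product is injective into the product of the
tensor products. -/
theorem eq_zero_of_finitePresentation [Module.FinitePresentation Rᵐᵒᵖ M]
    {x : BalancedTensor R M (∀ j, T j)}
    (h : ∀ j, map LinearMap.id (LinearMap.proj j : (∀ j, T j) →ₗ[R] T j) x = 0) : x = 0 := by
  obtain ⟨n, m, p, a, hp, hap⟩ := Module.FinitePresentation.exists_fin' Rᵐᵒᵖ M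
  obtain ⟨y, rfl⟩ := map_surjective hp x
  -- Each component of `y` comes from the relations `Rᵐ`; because `m` is finite, the chosen
  -- preimages assemble to one tensor over the product.
  have hz : ∀ j, ∃ z : BalancedTensor R (Fin m → Rᵐᵒᵖ) (T j), map a LinearMap.id z =
      map LinearMap.id (LinearMap.proj j : (∀ j, T j) →ₗ[R] T j) y := fun j =>
    mem_range_of_map_eq_zero hp (hap.linearMap_ker_eq).le (by rw [map_map_comm, h j])
  choose z hz using hz
  obtain ⟨w, hw⟩ := exists_pi_lift z
  have : map a LinearMap.id (ofPi (R := R) w) = y :=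
    pi_ext fun j => by rw [← map_map_comm, hw, hz]
  rw [← this, ← map_comp_left_apply, hap.linearMap_comp_eq_zero]
  generalize ofPi (R := R) w = v
  induction v using induction with
  | tmul c s => simp [zero_tmul]
  | zero => simp
  | add x y hx hy => rw [map_add, hx, hy, add_zero]

end Products

end BalancedTensor

/-- The quotient of `P × F`, with `P` finitely presented and `F` free, by a finitely generated
submodule is, as an object under `P`, equivalent to a finitely presented module. -/
theorem exists_finitePresentation_under_quotient {A P ι : Type u} [Ring A] [AddCommGroup P]
    [Module A P] [Module.FinitePresentation A P] (N : Submodule A (P × (ι →₀ A))) (hN : N.FG) :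
    ∃ Q : ModuleCat.{u} A, Module.FinitePresentation A Q ∧
      ∃ (α : (P × (ι →₀ A)) ⧸ N →ₗ[A] Q) (β : Q →ₗ[A] (P × (ι →₀ A)) ⧸ N),
        ∀ x : P, β (α (N.mkQ (x, 0))) = N.mkQ (x, 0) := by
  classical
  obtain ⟨s, rfl⟩ := hN
  -- The generators of `N` involve only the finitely many free coordinates in `X`. Restricting to
  -- them (`r`) and extending by zero (`j`) fixes both `N` and the image of `P`.
  let X : Finset ι := s.biUnion fun k => k.2.support
  let r : P × (ι →₀ A) →ₗ[A] P × (X →₀ A) :=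
    LinearMap.prodMap LinearMap.id (Finsupp.lcomapDomain Subtype.val Subtype.val_injective)
  let j : P × (X →₀ A) →ₗ[A] P × (ι →₀ A) :=
    LinearMap.prodMap LinearMap.id (Finsupp.lmapDomain A A Subtype.val)
  have hjr : ∀ k ∈ Submodule.span A (s : Set (P × (ι →₀ A))), j (r k) = k := by
    intro k hk
    induction hk using Submodule.span_induction with
    | mem k hk =>
      refine Prod.ext rfl ?_
      refine Finsupp.mapDomain_comapDomain _ Subtype.val_injective _ fun i hi => ?_
      rw [Subtype.range_coe_subtype]
      exact Finset.mem_biUnion.2 ⟨k, hk, hi⟩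
    | zero => simp
    | add x y _ _ hx hy => rw [map_add, map_add, hx, hy]
    | smul a x _ hx => rw [map_smul, map_smul, hx]
  set N := Submodule.span A (s : Set (P × (ι →₀ A)))
  refine ⟨ModuleCat.of A ((P × (X →₀ A)) ⧸ N.map r), ?_, N.mapQ (N.map r) r (N.le_comap_map r),
    (N.map r).mapQ N j ?_, fun x => ?_⟩
  · refine Module.finitePresentation_of_surjective (N.map r).mkQ (N.map r).mkQ_surjective ?_
    rw [Submodule.ker_mkQ]
    exact Submodule.FG.map r ⟨s, rfl⟩
  · rintro _ ⟨k, hk, rfl⟩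
    rw [Submodule.mem_comap, hjr k hk]
    exact hk
  · simp only [Submodule.mkQ_apply, Submodule.mapQ_apply, r, j]
    simp

/-- For `P → M`, a tensor in `P ⊗_R S` that vanishes in `M ⊗_R S` already vanishes
in the quotient of `P × R^(M)` by a finitely generated submodule of the kernel of
`P × R^(M) → M`. -/
theorem exists_fg_map_mkQ_inl_eq_zero {P : Type u} [AddCommGroup P] [Module Rᵐᵒᵖ P]
    (f : P →ₗ[Rᵐᵒᵖ] M) {x : BalancedTensor R P S}
    (hx : BalancedTensor.map f (LinearMap.id : S →ₗ[R] S) x = 0) :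
    ∃ N : Submodule Rᵐᵒᵖ (P × (M →₀ Rᵐᵒᵖ)), N.FG ∧
      N ≤ LinearMap.ker (f.coprod (Finsupp.linearCombination Rᵐᵒᵖ (id : M → M))) ∧
      BalancedTensor.map (N.mkQ ∘ₗ LinearMap.inl _ _ _) (LinearMap.id : S →ₗ[R] S) x = 0 := by
  obtain ⟨N, hN, hNp, h⟩ := BalancedTensor.exists_fg_map_mkQ_eq_zero (R := R)
    (p := f.coprod (Finsupp.linearCombination Rᵐᵒᵖ (id : M → M)))
    (fun m => ⟨(0, Finsupp.single m 1), by simp⟩)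
    (x := BalancedTensor.map (LinearMap.inl _ _ _) (LinearMap.id : S →ₗ[R] S) x)
    (by rw [← BalancedTensor.map_comp_left_apply, LinearMap.coprod_inl, hx])
  exact ⟨N, hN, hNp, by rw [BalancedTensor.map_comp_left_apply, h]⟩

end BalancedTensorLemmas

end FunctorialModules

/-! ### Module-theoretic criteria for Mittag-Leffler and strict Mittag-Leffler modules. -/

namespace FunctorialModules

section ModuleCriteria

variable {R : Type u} [Ring R]

/-- `M ⊗_R ∏ Tⱼ → ∏ M ⊗_R Tⱼ` is injective for all families `(Tⱼ)`. -/
def TensorSeparatesProducts (M : ModuleCat.{u} Rᵐᵒᵖ) : Prop :=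
  ∀ (n : ℕ) (m : Fin n → M) (I : Type u) (T : I → ModuleCat.{u} R) (y : Fin n → ∀ j, T j),
    (∀ j, ∑ i, BalancedTensor.tmul R (m i) (y i j) = 0) →
      ∑ i, BalancedTensor.tmul R (m i) (y i) = 0

/-- For every finite tuple `m` in `M`, the tuples `(φ mᵢ)`, for homomorphisms `φ` out of `M`, are
the annihilator of a tuple in a left module. -/
def HomOrbitsAreAnnihilators (M : ModuleCat.{u} Rᵐᵒᵖ) : Prop :=
  ∀ m : ℕ →₀ M, ∃ (W : ModuleCat.{u} R) (w : ℕ → W), ∀ (N : ModuleCat.{u} Rᵐᵒᵖ) (n : ℕ →₀ N),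
    (n.sum fun i x => BalancedTensor.tmul R x (w i)) = 0 ↔
      ∃ φ : M →ₗ[Rᵐᵒᵖ] N, ∀ i, φ (m i) = n i

variable {M : ModuleCat.{u} Rᵐᵒᵖ}

/-- The map `Rⁿ → M` given by the tuple has the same tensor kernels as a map to some finitely
presented `Q`, and `Q` separates products. -/
theorem IsMittagLeffler.tensorSeparatesProducts (hM : IsMittagLeffler M) :
    TensorSeparatesProducts M := fun n m I T y hy => by
  let f : (Fin n → Rᵐᵒᵖ) →ₗ[Rᵐᵒᵖ] M := Fintype.linearCombination Rᵐᵒᵖ m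
  have hf : ∀ (S : ModuleCat.{u} R) (s : Fin n → S), BalancedTensor.map f
      (LinearMap.id : S →ₗ[R] S) (BalancedTensor.ofPi s) =
        ∑ i, BalancedTensor.tmul R (m i) (s i) := fun S s => by
    simp [BalancedTensor.map_ofPi, f, Fintype.linearCombination_apply_single]
  obtain ⟨Q, hQ, g, hg⟩ : ∃ Q : ModuleCat.{u} Rᵐᵒᵖ, Module.FinitePresentation Rᵐᵒᵖ Q ∧
      ∃ g : (Fin n → Rᵐᵒᵖ) →ₗ[Rᵐᵒᵖ] Q, ∀ S : ModuleCat.{u} R,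
        (BalancedTensor.map f (LinearMap.id : S →ₗ[R] S)).ker =
          (BalancedTensor.map g (LinearMap.id : S →ₗ[R] S)).ker :=
    hM (ModuleCat.of _ (Fin n → Rᵐᵒᵖ))
      (inferInstanceAs (Module.FinitePresentation Rᵐᵒᵖ (Fin n → Rᵐᵒᵖ))) f
  have key : BalancedTensor.map g (LinearMap.id : (∀ j, T j) →ₗ[R] ∀ j, T j)
      (BalancedTensor.ofPi y) = 0 := by
    refine BalancedTensor.eq_zero_of_finitePresentation fun j => ?_
    rw [← BalancedTensor.map_map_comm, BalancedTensor.map_id_ofPi]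
    refine (hg (T j)).le ?_
    rw [AddMonoidHom.mem_ker]
    exact (hf (T j) _).trans (hy j)
  have := (hg (ModuleCat.of R (∀ j, T j))).ge key
  rw [AddMonoidHom.mem_ker] at this
  exact (hf (ModuleCat.of R (∀ j, T j)) y).symm.trans this

/-- `M` is the directed colimit of the quotients of `P × R^(M)` by the finitely generated `N ≤ ker
π`. The point is that a single `N` detects the kernel of `f ⊗ S` for all `S` at once. -/
theorem TensorSeparatesProducts.isMittagLeffler (hM : TensorSeparatesProducts M) :
    IsMittagLeffler M := fun P hP f => by
  obtain ⟨n, _, p, _, hp, _⟩ := Module.FinitePresentation.exists_fin' Rᵐᵒᵖ P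
  let π := f.coprod (Finsupp.linearCombination Rᵐᵒᵖ (id : M → M))
  let q (N : Submodule Rᵐᵒᵖ (P × (M →₀ Rᵐᵒᵖ))) := N.mkQ ∘ₗ LinearMap.inl Rᵐᵒᵖ P (M →₀ Rᵐᵒᵖ)
  obtain ⟨N, hN, hNπ, hNf⟩ : ∃ N : Submodule Rᵐᵒᵖ (P × (M →₀ Rᵐᵒᵖ)), N.FG ∧ N ≤ LinearMap.ker π ∧
      ∀ (S : ModuleCat.{u} R) (x : BalancedTensor R P S),
        BalancedTensor.map f LinearMap.id x = 0 →
          BalancedTensor.map (q N) (LinearMap.id : S →ₗ[R] S) x = 0 := by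
    -- If each `N` fails at some tensor `x N` over `S N`, the product of all the failures is killed
    -- by `f`, by separation. It then dies at one stage `N`, and projecting to the `N`-th factor
    -- contradicts the choice of `x N`.
    by_contra! H
    choose! S x hx hx' using H
    -- Lifting along `p` to `Rⁿ` makes it possible to assemble the counterexamples into one tensor
    -- over the product.
    have hz : ∀ N, ∃ z : BalancedTensor R (Fin n → Rᵐᵒᵖ) (S N),
        BalancedTensor.map p LinearMap.id z = x N := fun N => BalancedTensor.map_surjective hp _
    choose z hz using hz
    let J := {N : Submodule Rᵐᵒᵖ (P × (M →₀ Rᵐᵒᵖ)) // N.FG ∧ N ≤ LinearMap.ker π}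
    obtain ⟨y, hy⟩ := BalancedTensor.exists_pi_lift (I := J) (T := fun N => S N) fun N => z N
    have hfy : BalancedTensor.map f LinearMap.id
        (BalancedTensor.map p LinearMap.id (BalancedTensor.ofPi (R := R) y)) = 0 := by
      rw [← BalancedTensor.map_comp_left_apply, BalancedTensor.map_ofPi]
      refine hM n (fun i => f (p (Pi.single i 1))) J (fun N => S N) y fun N => ?_
      rw [← hx N N.2.1 N.2.2, ← hz, ← hy N, ← BalancedTensor.map_comp_left_apply,
        BalancedTensor.map_id_ofPi, BalancedTensor.map_ofPi]
      rfl
    obtain ⟨N, hN, hNπ, h⟩ := exists_fg_map_mkQ_inl_eq_zero f hfy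
    refine hx' N hN hNπ ?_
    let j : J := ⟨N, hN, hNπ⟩
    have := congrArg (BalancedTensor.map LinearMap.id
      (LinearMap.proj j : (∀ N : J, S N) →ₗ[R] S N)) h
    rw [map_zero, ← BalancedTensor.map_map_comm, ← BalancedTensor.map_map_comm, hy j, hz] at this
    exact this
  obtain ⟨Q, hQ, α, β, hαβ⟩ := exists_finitePresentation_under_quotient N hN
  have hβ : β ∘ₗ α ∘ₗ q N = q N := LinearMap.ext hαβ
  have hπ : N.liftQ π hNπ ∘ₗ q N = f := LinearMap.ext fun x => by simp [q, π]
  refine ⟨Q, hQ, α ∘ₗ q N, fun S => le_antisymm (fun x hx => ?_) fun x hx => ?_⟩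
  · rw [AddMonoidHom.mem_ker] at hx ⊢
    rw [BalancedTensor.map_comp_left_apply, hNf S x hx, map_zero]
  · rw [AddMonoidHom.mem_ker] at hx ⊢
    rw [← hπ, ← hβ, BalancedTensor.map_comp_left_apply, BalancedTensor.map_comp_left_apply, hx,
      map_zero, map_zero]

theorem isMittagLeffler_iff_tensorSeparatesProducts :
    IsMittagLeffler M ↔ TensorSeparatesProducts M :=
  ⟨fun h => h.tensorSeparatesProducts, fun h => h.isMittagLeffler⟩

/-- For a left module given by generators and relations, `∑ nᵢ ⊗ wᵢ` vanishes, where the `wᵢ` are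
the generators, if and only if `n` is a combination of the relations. -/
theorem sum_tmul_eq_zero_iff_of_presentation {ι : Type} {k : ℕ} (c : Fin k → ι →₀ R)
    (N : Type u) [AddCommGroup N] [Module Rᵐᵒᵖ N] (n : ι →₀ N) :
    (n.sum fun i x => BalancedTensor.tmul R x
        ((Submodule.span R (Set.range c)).mkQ (Finsupp.single i 1))) = 0 ↔
      ∃ z : Fin k → N, ∀ i, n i = ∑ b, op (c b i) • z b := by
  set U := Submodule.span R (Set.range c)
  let sm : N →+ R →+ N := AddMonoidHom.mk' (fun x => AddMonoidHom.mk' (fun r => op r • x)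
    fun r r' => by simp [add_smul]) fun x x' => by ext; simp
  let τ : N →+ (ι →₀ R) →+ (ι →₀ N) :=
    AddMonoidHom.mk' (fun x => Finsupp.mapRange.addMonoidHom (sm x)) fun x x' => by ext; simp
  have hτ : ∀ x g i, τ x g i = op (g i) • x := fun _ _ _ => rfl
  let κ : (Fin k → N) →+ (ι →₀ N) := AddMonoidHom.mk' (fun z => ∑ b, τ (z b) (c b))
    fun z z' => by simp [Finset.sum_add_distrib]
  let Φ : (ι →₀ N) →+ BalancedTensor R N ((ι →₀ R) ⧸ U) :=
    Finsupp.liftAddHom fun i => (BalancedTensor.mk (R := R)).flip (U.mkQ (Finsupp.single i 1))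
  have hΦ : ∀ n : ι →₀ N, Φ n = n.sum fun i x =>
    BalancedTensor.tmul R x (U.mkQ (Finsupp.single i 1)) := fun _ => rfl
  have hΦs : ∀ i x, Φ (Finsupp.single i x) =
      BalancedTensor.tmul R x (U.mkQ (Finsupp.single i 1)) := fun i x =>
    Finsupp.liftAddHom_apply_single _ _ _
  have hΦτ : ∀ x g, Φ (τ x g) = BalancedTensor.tmul R x (U.mkQ g) := fun x g => by
    induction g using Finsupp.induction_linear with
    | zero => simp [BalancedTensor.tmul_zero]
    | add g g' h h' => rw [map_add, map_add, h, h', map_add, BalancedTensor.tmul_add]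
    | single i r =>
      have : τ x (Finsupp.single i r) = Finsupp.single i (op r • x) :=
        Finsupp.mapRange_single (hf := map_zero (sm x))
      rw [this, hΦs, BalancedTensor.smul_tmul, ← map_smul, Finsupp.smul_single, smul_eq_mul, mul_one]
  -- `x` stays quantified in the induction, because in the scalar case `r` moves from `g` to `x`.
  have hU : ∀ g ∈ U, ∀ x, τ x g ∈ κ.range := fun g hg => by
    induction hg using Submodule.span_induction with
    | mem g hg =>
      obtain ⟨b, rfl⟩ := hg
      refine fun x => ⟨Pi.single b x, ?_⟩
      change ∑ b', τ ((Pi.single b x : Fin k → N) b') (c b') = _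
      rw [Finset.sum_eq_single b (fun b' _ hb => by simp [Pi.single_eq_of_ne hb]) (by simp)]
      simp
    | zero => exact fun x => by simp
    | add g g' _ _ h h' => exact fun x => by rw [map_add]; exact add_mem (h x) (h' x)
    | smul r g _ h =>
      intro x
      have : τ x (r • g) = τ (op r • x) g := by
        ext i
        simp [hτ, mul_smul]
      rw [this]
      exact h _
  -- This induces `Ψ` with `Ψ ∘ Φ` the quotient map by `κ.range`, which forces `ker Φ ≤ range κ`.
  let ψ : N →+ ((ι →₀ R) ⧸ U) →+ (ι →₀ N) ⧸ κ.range :=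
    AddMonoidHom.mk' (fun x => QuotientAddGroup.lift U.toAddSubgroup
      ((QuotientAddGroup.mk' κ.range).comp (τ x))
      fun g hg => (QuotientAddGroup.eq_zero_iff _).2 (hU g hg x)) fun x x' => by
        ext g
        obtain ⟨g, rfl⟩ := U.mkQ_surjective g
        change QuotientAddGroup.mk' κ.range (τ (x + x') g) =
          QuotientAddGroup.mk' κ.range (τ x g) + QuotientAddGroup.mk' κ.range (τ x' g)
        rw [map_add, AddMonoidHom.add_apply, map_add]
  let Ψ : BalancedTensor R N ((ι →₀ R) ⧸ U) →+ (ι →₀ N) ⧸ κ.range :=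
    BalancedTensor.lift ψ fun x r w => by
      obtain ⟨g, rfl⟩ := U.mkQ_surjective w
      rw [← map_smul]
      change QuotientAddGroup.mk' κ.range (τ (op r • x) g) =
        QuotientAddGroup.mk' κ.range (τ x (r • g))
      congr 1
      ext i
      simp [hτ, mul_smul]
  have hΨ : Ψ.comp Φ = QuotientAddGroup.mk' κ.range := by
    refine Finsupp.addHom_ext fun i x => ?_
    rw [AddMonoidHom.comp_apply, hΦs]
    change QuotientAddGroup.mk' κ.range (τ x (Finsupp.single i 1)) = _
    congr 1
    ext j
    rw [hτ]
    classical
    rw [Finsupp.single_apply, Finsupp.single_apply]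
    split_ifs <;> simp
  have hκ : ∀ z i, κ z i = ∑ b, op (c b i) • z b := fun z i => by
    change (∑ b, τ (z b) (c b)) i = _
    simp [Finsupp.finsetSum_apply, hτ]
  rw [← hΦ]
  constructor
  · intro h
    have := DFunLike.congr_fun hΨ n
    rw [AddMonoidHom.comp_apply, h, map_zero] at this
    obtain ⟨z, rfl⟩ := (QuotientAddGroup.eq_zero_iff n).1 this.symm
    exact ⟨z, hκ z⟩
  · rintro ⟨z, hz⟩
    obtain rfl : n = κ z := Finsupp.ext fun i => (hz i).trans (hκ z i).symm
    change Φ (∑ b, τ (z b) (c b)) = 0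
    rw [map_sum]
    refine Finset.sum_eq_zero fun b _ => ?_
    rw [hΦτ, Submodule.mkQ_apply, (Submodule.Quotient.mk_eq_zero _).2
      (Submodule.subset_span (Set.mem_range_self b)), BalancedTensor.tmul_zero]

/-- The tuples `(ψ pᵢ)`, for homomorphisms `ψ` out of a finitely presented module, are the
annihilator of a tuple in a left module. -/
theorem homOrbitsAreAnnihilators_of_finitePresentation (P : ModuleCat.{u} Rᵐᵒᵖ)
    [Module.FinitePresentation Rᵐᵒᵖ P] : HomOrbitsAreAnnihilators P := fun m => by
  obtain ⟨n, k, p, a, hp, hap⟩ := Module.FinitePresentation.exists_fin' Rᵐᵒᵖ P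
  obtain ⟨B, rfl⟩ := Finsupp.mapRange_surjective p (map_zero p) hp m
  -- A homomorphism out of `P` is a tuple `z ∈ Nⁿ` satisfying the `k` relations `a`. Row `b` of `c`
  -- records the `b`-th coordinates of the lifts `B i` and of the relations, so one linear system
  -- says both that `z` takes the values `t` and that it kills the relations.
  let c (b : Fin n) : ℕ ⊕ Fin k →₀ R := Finsupp.sumElim
    (B.mapRange (fun v => unop (v b)) rfl)
    (Finsupp.equivFunOnFinite.symm fun l => unop (a (Pi.single l 1) b))
  refine ⟨ModuleCat.of R ((ℕ ⊕ Fin k →₀ R) ⧸ Submodule.span R (Set.range c)),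
    fun i => (Submodule.span R (Set.range c)).mkQ (Finsupp.single (Sum.inl i) 1), fun N t => ?_⟩
  -- Extending `t` by zero on `Fin k` encodes that the relations must go to zero.
  have h := sum_tmul_eq_zero_iff_of_presentation c N (t.embDomain Function.Embedding.inl)
  rw [Finsupp.sum_embDomain] at h
  refine h.trans ⟨?_, ?_⟩
  · rintro ⟨z, hz⟩
    let ζ : (Fin n → Rᵐᵒᵖ) →ₗ[Rᵐᵒᵖ] N := Fintype.linearCombination Rᵐᵒᵖ z
    have hζ : ζ ∘ₗ a = 0 := by
      refine LinearMap.pi_ext' fun l => LinearMap.ext_ring ?_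
      have := hz (Sum.inr l)
      rw [Finsupp.embDomain_of_notMem_range _ _ _ (by simp)] at this
      simpa [c, ζ, Fintype.linearCombination_apply] using this.symm
    have hker : LinearMap.ker p ≤ LinearMap.ker ζ := by
      rw [hap.linearMap_ker_eq]
      exact LinearMap.range_le_ker_iff.2 hζ
    refine ⟨(LinearMap.ker p).liftQ ζ hker ∘ₗ
      (p.quotKerEquivOfSurjective hp).symm.toLinearMap, fun i => ?_⟩
    have hs : (p.quotKerEquivOfSurjective hp).symm (p (B i)) = (LinearMap.ker p).mkQ (B i) := by
      rw [LinearEquiv.symm_apply_eq]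
      rfl
    have := hz (Sum.inl i)
    rw [show (Sum.inl i : ℕ ⊕ Fin k) = Function.Embedding.inl i from rfl,
      Finsupp.embDomain_apply_self] at this
    rw [Finsupp.mapRange_apply, LinearMap.comp_apply, LinearEquiv.coe_coe, hs,
      Submodule.mkQ_apply, Submodule.liftQ_apply, this]
    simp [ζ, c, Fintype.linearCombination_apply]
  · rintro ⟨ψ, hψ⟩
    have hpi : ∀ v : Fin n → Rᵐᵒᵖ, ψ (p v) = ∑ b, v b • ψ (p (Pi.single b 1)) := fun v => by
      have : ψ ∘ₗ p = Fintype.linearCombination Rᵐᵒᵖ fun b => ψ (p (Pi.single b 1)) :=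
        LinearMap.pi_ext' fun b => LinearMap.ext_ring
          (by simp [Fintype.linearCombination_apply_single])
      exact (DFunLike.congr_fun this v).trans (Fintype.linearCombination_apply _ _ _)
    refine ⟨fun b => ψ (p (Pi.single b 1)), ?_⟩
    rintro (i | l)
    · rw [show (Sum.inl i : ℕ ⊕ Fin k) = Function.Embedding.inl i from rfl,
        Finsupp.embDomain_apply_self, ← hψ, Finsupp.mapRange_apply, hpi]
      simp [c]
    · rw [Finsupp.embDomain_of_notMem_range _ _ _ (by simp)]
      have := hpi (a (Pi.single l 1))
      rw [hap.apply_apply_eq_zero, map_zero] at this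
      simpa [c] using this

/-- Since `g ∘ f` fixes every `m i`, the tuples `(φ mᵢ)` for `φ` out of `M` are the tuples `(ψ (f
mᵢ))` for `ψ` out of `P`, so the pair `(W, w)` found for `P` serves. -/
theorem IsStrictMittagLeffler.homOrbitsAreAnnihilators (hM : IsStrictMittagLeffler M) :
    HomOrbitsAreAnnihilators M := fun m => by
  obtain ⟨P, hP, f, g, hgf⟩ := hM (Submodule.span _ (Set.range m))
    (Submodule.fg_span m.finite_range)
  have hm : ∀ i, g (f (m i)) = m i := fun i =>
    DFunLike.congr_fun hgf ⟨m i, Submodule.subset_span (Set.mem_range_self i)⟩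
  obtain ⟨W, w, hw⟩ := homOrbitsAreAnnihilators_of_finitePresentation P
    (m.mapRange f (map_zero f))
  refine ⟨W, w, fun N n => (hw N n).trans ⟨?_, ?_⟩⟩
  · rintro ⟨ψ, hψ⟩
    exact ⟨ψ ∘ₗ f, hψ⟩
  · rintro ⟨φ, hφ⟩
    exact ⟨φ ∘ₗ g, fun i => by simp [hm, hφ]⟩

/-- The identity of `M` shows that the generators `a` annihilate `w`. This relation already holds in
a finitely presented `Q` over `M`, and the annihilator property in `Q` then produces the map `M →
Q`. -/
theorem HomOrbitsAreAnnihilators.isStrictMittagLeffler (hM : HomOrbitsAreAnnihilators M) :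
    IsStrictMittagLeffler M := fun L hL => by
  obtain ⟨k, a, rfl⟩ := Submodule.fg_iff_exists_fin_generating_family.1 hL
  let ext (N : ModuleCat.{u} Rᵐᵒᵖ) (v : Fin k → N) : ℕ →₀ N :=
    Finsupp.embDomain Fin.valEmbedding (Finsupp.equivFunOnFinite.symm v)
  have hext : ∀ (N : ModuleCat.{u} Rᵐᵒᵖ) (v : Fin k → N) (i : Fin k), ext N v i = v i :=
    fun N v i => Finsupp.embDomain_apply_self _ _ i
  obtain ⟨W, w, hw⟩ := hM (ext M a)
  have hsum : ∀ (N : ModuleCat.{u} Rᵐᵒᵖ) (v : Fin k → N),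
      ((ext N v).sum fun i x => BalancedTensor.tmul R x (w i)) =
        ∑ i : Fin k, BalancedTensor.tmul R (v i) (w i) := fun N v => by
    rw [Finsupp.sum_embDomain]
    exact Finsupp.sum_fintype _ _ fun i => BalancedTensor.zero_tmul _
  let f : (Fin k → Rᵐᵒᵖ) →ₗ[Rᵐᵒᵖ] M := Fintype.linearCombination Rᵐᵒᵖ a
  have hf : ∀ i, f (Pi.single i 1) = a i := fun i => by
    simp [f, Fintype.linearCombination_apply_single]
  have h0 : BalancedTensor.map f LinearMap.id
      (BalancedTensor.ofPi (R := R) fun i : Fin k => w i) = 0 := by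
    rw [BalancedTensor.map_ofPi]
    simp only [hf, LinearMap.id_apply]
    exact (hsum M a).symm.trans ((hw M _).2 ⟨LinearMap.id, fun i => rfl⟩)
  obtain ⟨N, hN, hNπ, h⟩ := exists_fg_map_mkQ_inl_eq_zero f h0
  obtain ⟨Q, hQ, α, β, hαβ⟩ := exists_finitePresentation_under_quotient N hN
  let q := N.mkQ ∘ₗ LinearMap.inl Rᵐᵒᵖ (Fin k → Rᵐᵒᵖ) (M →₀ Rᵐᵒᵖ)
  replace h := congrArg (BalancedTensor.map α LinearMap.id) h
  rw [← BalancedTensor.map_comp_left_apply, BalancedTensor.map_ofPi, map_zero] at h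
  -- The images in `Q` of the standard basis annihilate `w`, so they are the values at `a` of some
  -- `φ : M → Q`; going back to `M` returns `a`.
  obtain ⟨φ, hφ⟩ := (hw Q (ext Q fun i => α (q (Pi.single i 1)))).1 ((hsum _ _).trans h)
  refine ⟨Q, hQ, φ, N.liftQ _ hNπ ∘ₗ β, ?_⟩
  have hφ' : ∀ i : Fin k, φ (a i) = α (q (Pi.single i 1)) := fun i => by
    have := hφ i
    rwa [hext, hext] at this
  refine LinearMap.ext fun x => ?_
  obtain ⟨x, hx⟩ := x
  refine LinearMap.eqOn_span (f := (N.liftQ _ hNπ ∘ₗ β) ∘ₗ φ) (g := LinearMap.id) ?_ hx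
  rintro _ ⟨i, rfl⟩
  rw [LinearMap.comp_apply, LinearMap.comp_apply, hφ']
  refine (congrArg (N.liftQ _ hNπ) (hαβ (Pi.single i 1))).trans ?_
  simp [hf]

theorem isStrictMittagLeffler_iff_homOrbitsAreAnnihilators :
    IsStrictMittagLeffler M ↔ HomOrbitsAreAnnihilators M :=
  ⟨fun h => h.homOrbitsAreAnnihilators, fun h => h.isStrictMittagLeffler⟩

end ModuleCriteria

end FunctorialModules

/-! ### Pointwise kernels, cokernels and products of functors. -/

namespace FunctorialModules

noncomputable section FunctorLemmas

/-- The forgetful functor to types preserves and reflects these limits. The smallness assumption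
covers both `ℕ` and index types from a lower universe. -/
theorem nonempty_isLimit_fan_iff {J : Type*} [Small.{u} J]
    {A : J → AddCommGrpCat.{u}} (c : Fan A) :
    Nonempty (IsLimit c) ↔ ∀ x : ∀ j, A j, ∃! y : c.pt, ∀ j, c.proj j y = x j := by
  have : Nonempty (IsLimit c) ↔ Nonempty (IsLimit ((forget AddCommGrpCat).mapCone c)) :=
    ⟨fun ⟨h⟩ => ⟨isLimitOfPreserves _ h⟩, fun ⟨h⟩ => ⟨isLimitOfReflects _ h⟩⟩
  rw [this, Types.isLimit_iff]
  constructor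
  · intro h x
    obtain ⟨y, hy, hy'⟩ := h (fun j => x j.as) (by
      rintro ⟨j⟩ ⟨j'⟩ g
      obtain rfl : j = j' := Discrete.eq_of_hom g
      obtain rfl : g = 𝟙 _ := Subsingleton.elim _ _
      simp)
    exact ⟨y, fun j => hy ⟨j⟩, fun z hz => hy' z fun j => hz j.as⟩
  · intro h s _
    obtain ⟨y, hy, hy'⟩ := h fun j => s ⟨j⟩
    exact ⟨y, fun j => hy j.as, fun z hz => hy' z fun j => hz ⟨j⟩⟩

variable {R : Type u} [Ring R]

theorem preservesDirectProducts_iff (F : FunctorOfModules R) :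
    PreservesDirectProducts F ↔ ∀ (I : Type u) (T : I → ModuleCat.{u} R) (x : ∀ j, F.obj (T j)),
      ∃! y : F.obj (ModuleCat.of R (∀ j, T j)),
        ∀ j, F.map (ModuleCat.ofHom (LinearMap.proj j)) y = x j := by
  constructor
  · intro h I T
    have := h I
    exact (nonempty_isLimit_fan_iff _).1
      ⟨isLimitFanMkObjOfIsLimit F T _ (ModuleCat.productConeIsLimit T)⟩
  · intro h I
    refine ⟨fun {K} => ?_⟩
    have hK : PreservesLimit (Discrete.functor (K.obj ∘ Discrete.mk)) F :=
      preservesLimit_of_preserves_limit_cone (ModuleCat.productConeIsLimit _)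
        ((isLimitMapConeFanMkEquiv F _ _).symm
          ((nonempty_isLimit_fan_iff _).2 (h I fun j => K.obj ⟨j⟩)).some)
    exact preservesLimit_of_iso_diagram F Discrete.natIsoFunctor.symm

theorem app_injective_of_mono {F G : FunctorOfModules R} (f : F ⟶ G) [Mono f]
    (S : ModuleCat.{u} R) : Function.Injective (f.app S) :=
  (AddCommGrpCat.mono_iff_injective _).1 inferInstance

theorem app_surjective_of_epi {F G : FunctorOfModules R} (f : F ⟶ G) [Epi f]
    (S : ModuleCat.{u} R) : Function.Surjective (f.app S) :=
  (AddCommGrpCat.epi_iff_surjective _).1 inferInstance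

theorem app_comp_eq_zero {F G H : FunctorOfModules R} {f : F ⟶ G} {g : G ⟶ H} (h : f ≫ g = 0)
    (S : ModuleCat.{u} R) (x : F.obj S) : g.app S (f.app S x) = 0 :=
  congrArg (fun η : F ⟶ H => η.app S x) h

theorem exists_kernel_ι_app {F G : FunctorOfModules R} (f : F ⟶ G) {S : ModuleCat.{u} R}
    {x : F.obj S} (hx : f.app S x = 0) : ∃ y, (kernel.ι f).app S y = x :=
  (ShortComplex.ab_exact_iff _).1
    ((ShortComplex.exact_kernel f).map ((evaluation _ _).obj S)) x hx

theorem exists_app_of_cokernel_π_app {F G : FunctorOfModules R} (f : F ⟶ G) {S : ModuleCat.{u} R}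
    {x : G.obj S} (hx : (cokernel.π f).app S x = 0) : ∃ y, f.app S y = x :=
  (ShortComplex.ab_exact_iff _).1
    ((ShortComplex.exact_cokernel f).map ((evaluation _ _).obj S)) x hx

theorem naturality_app {F G : FunctorOfModules R} (f : F ⟶ G) {S T : ModuleCat.{u} R}
    (g : S ⟶ T) (x : F.obj S) : f.app T (F.map g x) = G.map g (f.app S x) :=
  congrArg (fun η : F.obj S ⟶ G.obj T => η x) (f.naturality g)

/-- Components in the kernel glue to a unique element of `F`, as `F` preserves products; the only
question is whether that element lies in the kernel. -/
theorem preservesDirectProducts_kernel_iff {F G : FunctorOfModules R} (f : F ⟶ G)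
    (hF : PreservesDirectProducts F) :
    PreservesDirectProducts (kernel f) ↔ ∀ (I : Type u) (T : I → ModuleCat.{u} R)
      (y : F.obj (ModuleCat.of R (∀ j, T j))),
      (∀ j, f.app (T j) (F.map (ModuleCat.ofHom (LinearMap.proj j)) y) = 0) → f.app _ y = 0 := by
  rw [preservesDirectProducts_iff] at hF ⊢
  have hι := fun S x => app_comp_eq_zero (kernel.condition f) S x
  constructor
  · intro h I T y hy
    choose x hx using fun j => exists_kernel_ι_app f (hy j)
    obtain ⟨z, hz, -⟩ := h I T x
    have : (kernel.ι f).app _ z = y := (hF I T _).unique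
      (fun j => by rw [← naturality_app, hz, hx]) fun j => rfl
    rw [← this, hι]
  · intro h I T x
    obtain ⟨y, hy, -⟩ := hF I T fun j => (kernel.ι f).app _ (x j)
    obtain ⟨z, rfl⟩ := exists_kernel_ι_app f (h I T y fun j => by rw [hy, hι])
    refine ⟨z, fun j => app_injective_of_mono (kernel.ι f) _ ?_, fun z' hz' =>
      app_injective_of_mono (kernel.ι f) _ ((hF I T _).unique (fun j => rfl) fun j => ?_)⟩
    · rw [naturality_app, hy]
    · rw [hy, ← naturality_app, hz']

/-- Exactness and monomorphisms are pointwise, so embedding the cokernel amounts to realising the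
image of `f` as the kernel of a morphism out of `G`. -/
theorem exists_mono_cokernel_iff {F G : FunctorOfModules R} (f : F ⟶ G) (H : FunctorOfModules R) :
    (∃ i : cokernel f ⟶ H, Mono i) ↔
      ∃ t : G ⟶ H, ∀ S (x : G.obj S), t.app S x = 0 ↔ ∃ y, f.app S y = x := by
  have hπ := fun S x => app_comp_eq_zero (cokernel.condition f) S x
  constructor
  · rintro ⟨i, _⟩
    refine ⟨cokernel.π f ≫ i, fun S x => ⟨fun h => exists_app_of_cokernel_π_app f ?_, ?_⟩⟩
    · exact app_injective_of_mono i S (h.trans (map_zero (i.app S).hom).symm)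
    · rintro ⟨y, rfl⟩
      exact (congrArg (i.app S) (hπ S y)).trans (map_zero (i.app S).hom)
  · rintro ⟨t, ht⟩
    have hft : f ≫ t = 0 := by
      ext S y
      exact (ht S _).2 ⟨y, rfl⟩
    refine ⟨cokernel.desc f t hft, ?_⟩
    have : ∀ S, Mono ((cokernel.desc f t hft).app S) := fun S => by
      rw [AddCommGrpCat.mono_iff_injective]
      refine (injective_iff_map_eq_zero ((cokernel.desc f t hft).app S).hom).2 fun x hx => ?_
      obtain ⟨x, rfl⟩ := app_surjective_of_epi (cokernel.π f) S x
      have htx : t.app S x = 0 := by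
        rw [← cokernel.π_desc f t hft]
        exact hx
      obtain ⟨y, rfl⟩ := (ht S x).1 htx
      exact hπ S y
    exact NatTrans.mono_of_mono_app _

end FunctorLemmas

end FunctorialModules

/-! ### Morphisms `∏_ℕ 𝓡 → 𝓜` and their kernels. -/

namespace FunctorialModules

noncomputable section MittagLefflerFunctors

variable {R : Type u} [Ring R]

/-- The isomorphism `R ⊗_R S → S`. -/
def tensorUnitLeft (S : Type u) [AddCommGroup S] [Module R S] : BalancedTensor R R S →+ S :=
  BalancedTensor.lift (AddMonoidHom.mk' (fun r : R => AddMonoidHom.mk' (fun s => r • s)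
    (smul_add r)) fun r r' => by ext; simp [add_smul]) fun r a s => by simp [mul_smul]

theorem tensorUnitLeft_tmul {S : Type u} [AddCommGroup S] [Module R S] (r : R) (s : S) :
    tensorUnitLeft S (BalancedTensor.tmul R r s) = r • s :=
  rfl

theorem one_tmul_tensorUnitLeft {S : Type u} [AddCommGroup S] [Module R S]
    (x : BalancedTensor R R S) : BalancedTensor.tmul R (1 : R) (tensorUnitLeft S x) = x := by
  induction x using BalancedTensor.induction with
  | tmul r s => rw [tensorUnitLeft_tmul, ← BalancedTensor.smul_tmul]; simp
  | zero => rw [map_zero, BalancedTensor.tmul_zero]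
  | add x y hx hy => rw [map_add, BalancedTensor.tmul_add, hx, hy]

theorem tensorUnitLeft_map {S T : Type u} [AddCommGroup S] [Module R S] [AddCommGroup T]
    [Module R T] (g : S →ₗ[R] T) (x : BalancedTensor R R S) :
    tensorUnitLeft T (BalancedTensor.map LinearMap.id g x) = g (tensorUnitLeft S x) := by
  induction x using BalancedTensor.induction with
  | tmul r s => simp [tensorUnitLeft_tmul]
  | zero => simp
  | add x y hx hy => simp only [map_add, hx, hy]

variable (R) in
/-- The product of countably many copies of `𝓡`. -/
abbrev natPower : FunctorOfModules R :=
  ∏ᶜ fun _ : ℕ => quasiCoherent (ModuleCat.of Rᵐᵒᵖ R)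

/-- The coordinates of an element of `(∏_ℕ 𝓡)(S)`. -/
def natPowerCoord (S : ModuleCat.{u} R) (i : ℕ) : (natPower R).obj S →+ S :=
  ((tensorUnitLeft S).comp AddEquiv.ulift.toAddMonoidHom).comp
    ((Pi.π (fun _ : ℕ => quasiCoherent (ModuleCat.of Rᵐᵒᵖ R)) i).app S).hom

theorem natPowerCoord_map {S T : ModuleCat.{u} R} (g : S ⟶ T) (i : ℕ) (y : (natPower R).obj S) :
    natPowerCoord T i ((natPower R).map g y) = g (natPowerCoord S i y) :=
  (congrArg (fun z : ULift (BalancedTensor R R T) => tensorUnitLeft T z.down)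
    (naturality_app (Pi.π (fun _ : ℕ => quasiCoherent (ModuleCat.of Rᵐᵒᵖ R)) i) g y)).trans
    (tensorUnitLeft_map g.hom _)

theorem natPower_existsUnique (S : ModuleCat.{u} R) (s : ℕ → S) :
    ∃! y : (natPower R).obj S, ∀ i, natPowerCoord S i y = s i := by
  obtain ⟨y, hy, hy'⟩ := (nonempty_isLimit_fan_iff _).1
    ⟨isLimitFanMkObjOfIsLimit ((evaluation _ _).obj S) _ _
      (productIsProduct fun _ : ℕ => quasiCoherent (ModuleCat.of Rᵐᵒᵖ R))⟩
    fun i => ULift.up (BalancedTensor.tmul R (1 : R) (s i))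
  refine ⟨y, fun i => ?_, fun z hz => hy' z fun i => ?_⟩
  · exact (congrArg (fun z : ULift (BalancedTensor R R S) => tensorUnitLeft S z.down)
      (hy i)).trans (one_smul R (s i))
  · refine ULift.ext _ _ ?_
    rw [← hz i]
    exact (one_tmul_tensorUnitLeft _).symm

/-- In coordinates this is the exchange of indices `(∏ Tⱼ)^ℕ = ∏ Tⱼ^ℕ`. -/
theorem preservesDirectProducts_natPower : PreservesDirectProducts (natPower R) := by
  rw [preservesDirectProducts_iff]
  intro I T x
  obtain ⟨y, hy, hy'⟩ := natPower_existsUnique (ModuleCat.of R (∀ j, T j))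
    fun i j => natPowerCoord (T j) i (x j)
  refine ⟨y, fun j => (natPower_existsUnique (T j) fun i => natPowerCoord (T j) i (x j)).unique
    (fun i => ?_) fun i => rfl, fun z hz => hy' z fun i => ?_⟩
  · rw [natPowerCoord_map, hy]
    rfl
  · funext j
    rw [← hz j, natPowerCoord_map]
    rfl

theorem exists_finsupp_eq_sum_tmul_single {M : Type u} [AddCommGroup M] [Module Rᵐᵒᵖ M]
    (x : BalancedTensor R M (ℕ →₀ R)) :
    ∃ c : ℕ →₀ M, x = c.sum fun i m => BalancedTensor.tmul R m (Finsupp.single i (1 : R)) := by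
  let Φ : (ℕ →₀ M) →+ BalancedTensor R M (ℕ →₀ R) :=
    Finsupp.liftAddHom fun i => (BalancedTensor.mk (R := R)).flip (Finsupp.single i 1)
  suffices x ∈ Φ.range by
    obtain ⟨c, rfl⟩ := this
    exact ⟨c, rfl⟩
  induction x using BalancedTensor.induction with
  | tmul m s =>
    induction s using Finsupp.induction_linear with
    | zero => rw [BalancedTensor.tmul_zero]; exact zero_mem _
    | add s s' h h' => rw [BalancedTensor.tmul_add]; exact add_mem h h'
    | single i r =>
      refine ⟨Finsupp.single i (op r • m), (Finsupp.liftAddHom_apply_single _ _ _).trans ?_⟩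
      rw [AddMonoidHom.flip_apply, BalancedTensor.mk_apply, BalancedTensor.smul_tmul,
        Finsupp.smul_single, smul_eq_mul, mul_one]
  | zero => exact zero_mem _
  | add x y hx hy => exact add_mem hx hy

theorem exists_sum_eq_sum_fin {M : Type u} [AddCommGroup M] [Module Rᵐᵒᵖ M] (c : ℕ →₀ M) :
    ∃ n : ℕ, ∀ (S : ModuleCat.{u} R) (s : ℕ → S),
      (c.sum fun i m => BalancedTensor.tmul R m (s i)) =
        ∑ i : Fin n, BalancedTensor.tmul R (c i) (s i) := by
  obtain ⟨n, hn⟩ := c.support.exists_nat_subset_range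
  refine ⟨n, fun S s => ?_⟩
  exact (Finsupp.sum_of_support_subset _ hn _ fun i _ => BalancedTensor.zero_tmul (s i)).trans
    (Finset.sum_range _)

variable {M : ModuleCat.{u} Rᵐᵒᵖ}

theorem exists_tuple_of_natPower_hom (f : natPower R ⟶ quasiCoherent M) :
    ∃ (n : ℕ) (m : Fin n → M), ∀ (S : ModuleCat.{u} R) (y : (natPower R).obj S),
      (f.app S y : ULift (BalancedTensor R M S)).down =
        ∑ i : Fin n, BalancedTensor.tmul R (m i) (natPowerCoord S i y) := by
  -- The universal element for Yoneda: every `y` is the image of `y₀` under the map `R^(ℕ) → S` with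
  -- the coordinates of `y`. Finiteness of the tuple comes from the finite support of `c`.
  obtain ⟨y₀, hy₀, -⟩ := natPower_existsUnique (ModuleCat.of R (ℕ →₀ R))
    fun i => Finsupp.single i (1 : R)
  obtain ⟨c, hc⟩ := exists_finsupp_eq_sum_tmul_single
    (f.app _ y₀ : ULift (BalancedTensor R M (ℕ →₀ R))).down
  obtain ⟨n, hn⟩ := exists_sum_eq_sum_fin (R := R) c
  refine ⟨n, fun i => c i, fun S y => ?_⟩
  let g : (ℕ →₀ R) →ₗ[R] S := Finsupp.linearCombination R fun i => natPowerCoord S i y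
  have hg : ∀ i, g (Finsupp.single i 1) = natPowerCoord S i y := fun i => by simp [g]
  have hy : (natPower R).map (ModuleCat.ofHom g) y₀ = y :=
    (natPower_existsUnique S fun i => natPowerCoord S i y).unique
      (fun i => by
        rw [natPowerCoord_map, hy₀]
        exact hg i) fun i => rfl
  have h1 : (f.app S y : ULift (BalancedTensor R M S)).down = BalancedTensor.map LinearMap.id g
      (f.app _ y₀ : ULift (BalancedTensor R M (ℕ →₀ R))).down := by
    conv_lhs => rw [← hy]
    exact congrArg ULift.down (naturality_app f (ModuleCat.ofHom g) y₀)
  rw [h1, hc, map_finsuppSum, ← hn S fun i => natPowerCoord S i y]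
  refine Finsupp.sum_congr fun i _ => ?_
  rw [BalancedTensor.map_tmul, hg]
  rfl

/-- The morphism `∏_ℕ 𝓡 → 𝓜` given by a finite tuple in `M`. -/
def natPowerHom {n : ℕ} (m : Fin n → M) : natPower R ⟶ quasiCoherent M where
  app S := AddCommGrpCat.ofHom (AddMonoidHom.mk'
    (fun y => ULift.up (∑ i : Fin n, BalancedTensor.tmul R (m i) (natPowerCoord S i y)))
    fun y y' => by
      refine ULift.ext _ _ ?_
      simp [BalancedTensor.tmul_add, Finset.sum_add_distrib])
  naturality S T g := by
    ext y
    refine ULift.ext _ _ ?_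
    change ∑ i : Fin n, BalancedTensor.tmul R (m i) (natPowerCoord T i ((natPower R).map g y)) =
      BalancedTensor.map LinearMap.id g.hom
        (∑ i : Fin n, BalancedTensor.tmul R (m i) (natPowerCoord S i y))
    simp only [natPowerCoord_map, map_sum, BalancedTensor.map_tmul]
    rfl

theorem tensorSeparatesProducts_iff_kernels :
    TensorSeparatesProducts M ↔
      ∀ f : natPower R ⟶ quasiCoherent M, PreservesDirectProducts (kernel f) := by
  simp_rw [preservesDirectProducts_kernel_iff _ preservesDirectProducts_natPower]
  constructor
  · intro h f I T y hy
    obtain ⟨n, m, hf⟩ := exists_tuple_of_natPower_hom f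
    refine ULift.ext _ _ ((hf _ y).trans ?_)
    refine h n m I T (fun i => natPowerCoord _ i y) fun j => ?_
    refine Eq.trans ?_ ((hf _ _).symm.trans (congrArg ULift.down (hy j)))
    exact Finset.sum_congr rfl fun i _ => congrArg (BalancedTensor.tmul R (m i))
      (natPowerCoord_map (ModuleCat.ofHom (LinearMap.proj j)) i y).symm
  · intro h n m I T s hs
    obtain ⟨y, hy, -⟩ := natPower_existsUnique (ModuleCat.of R (∀ j, T j))
      -- The padding is harmless, as `natPowerHom m` reads only the first `n` coordinates.
      fun i => if hi : i < n then s ⟨i, hi⟩ else 0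
    replace hy : ∀ i : Fin n, natPowerCoord (ModuleCat.of R (∀ j, T j)) i y = s i := fun i => by
      rw [hy, dif_pos i.2]
    have := congrArg ULift.down (h (natPowerHom m) I T y fun j => ULift.ext _ _ ?_)
    · refine Eq.trans ?_ this
      exact Finset.sum_congr rfl fun i _ => congrArg (BalancedTensor.tmul R (m i)) (hy i).symm
    · refine Eq.trans ?_ (hs j)
      change ∑ i : Fin n, BalancedTensor.tmul R (m i) (natPowerCoord (T j) i
        ((natPower R).map (ModuleCat.ofHom (LinearMap.proj j)) y)) = _
      refine Finset.sum_congr rfl fun i _ => congrArg (BalancedTensor.tmul R (m i)) ?_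
      rw [natPowerCoord_map, hy]
      rfl

end MittagLefflerFunctors

end FunctorialModules

/-! ### Morphisms `𝓜^* → ⨁_ℕ 𝓡` and their cokernels. -/

namespace FunctorialModules

noncomputable section StrictMittagLefflerFunctors

variable {R : Type u} [Ring R]

/-- The isomorphism `N ⊗_R R → N`. -/
def tensorUnitRight (N : Type u) [AddCommGroup N] [Module Rᵐᵒᵖ N] : BalancedTensor R N R →+ N :=
  BalancedTensor.lift (AddMonoidHom.mk' (fun x => AddMonoidHom.mk' (fun r : R => op r • x)
    fun r r' => by simp [add_smul]) fun x x' => by ext; simp) fun x r a => by simp [mul_smul]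

theorem tensorUnitRight_tmul {N : Type u} [AddCommGroup N] [Module Rᵐᵒᵖ N] (x : N) (r : R) :
    tensorUnitRight N (BalancedTensor.tmul R x r) = op r • x :=
  rfl

theorem tensorUnitRight_tmul_one {N : Type u} [AddCommGroup N] [Module Rᵐᵒᵖ N]
    (x : BalancedTensor R N R) : BalancedTensor.tmul R (tensorUnitRight N x) (1 : R) = x := by
  induction x using BalancedTensor.induction with
  | tmul x r => rw [tensorUnitRight_tmul, BalancedTensor.smul_tmul, smul_eq_mul, mul_one]
  | zero => rw [map_zero, BalancedTensor.zero_tmul]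
  | add x y hx hy => rw [map_add, BalancedTensor.add_tmul, hx, hy]

theorem map_eq_tensorUnitRight_tmul {N S : Type u} [AddCommGroup N] [Module Rᵐᵒᵖ N]
    [AddCommGroup S] [Module R S] (g : R →ₗ[R] S) (x : BalancedTensor R N R) :
    BalancedTensor.map LinearMap.id g x = BalancedTensor.tmul R (tensorUnitRight N x) (g 1) := by
  conv_lhs => rw [← tensorUnitRight_tmul_one x]
  rfl

variable {M : ModuleCat.{u} Rᵐᵒᵖ}

/-- Morphisms of quasi-coherent modules come from homomorphisms of modules. -/
theorem exists_eq_tensorBifunctor_map {N : ModuleCat.{u} Rᵐᵒᵖ}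
    (η : quasiCoherent M ⟶ quasiCoherent N) :
    ∃ φ : M →ₗ[Rᵐᵒᵖ] N, η = (tensorBifunctor R).map (ModuleCat.ofHom φ) := by
  let e (S : ModuleCat.{u} R) : BalancedTensor R M S →+ BalancedTensor R N S :=
    (AddEquiv.ulift.toAddMonoidHom.comp (η.app S).hom).comp AddEquiv.ulift.symm.toAddMonoidHom
  have he : ∀ {S T : ModuleCat.{u} R} (g : S →ₗ[R] T) (x : BalancedTensor R M S),
      e T (BalancedTensor.map LinearMap.id g x) = BalancedTensor.map LinearMap.id g (e S x) :=
    fun g x => congrArg ULift.down (naturality_app η (ModuleCat.ofHom g) (ULift.up x))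
  -- Every `s` is `g 1` for some `g : R → S`, so naturality determines `η` by its values at `m ⊗ 1`
  -- in `M ⊗ R`.
  have key : ∀ (S : ModuleCat.{u} R) (g : R →ₗ[R] S) (m : M),
      e S (BalancedTensor.tmul R m (g 1)) = BalancedTensor.tmul R
        (tensorUnitRight N (e (ModuleCat.of R R) (BalancedTensor.tmul R m (1 : R)))) (g 1) :=
    fun S g m => (he (S := ModuleCat.of R R) g (BalancedTensor.tmul R m (1 : R))).trans
      (map_eq_tensorUnitRight_tmul g _)
  let φ : M →ₗ[Rᵐᵒᵖ] N :=
    { toFun := fun m =>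
        tensorUnitRight N (e (ModuleCat.of R R) (BalancedTensor.tmul R m (1 : R)))
      map_add' := fun m m' => by rw [BalancedTensor.add_tmul, map_add, map_add]
      map_smul' := fun r m => by
        -- Linearity is naturality for right multiplication by `unop r` on the left module `R`.
        have := key (ModuleCat.of R R) (LinearMap.toSpanSingleton R R (unop r)) m
        rw [LinearMap.toSpanSingleton_apply, one_smul] at this
        have h1 : BalancedTensor.tmul R (r • m) (1 : R) = BalancedTensor.tmul R m (unop r) := by
          rw [← op_unop r, BalancedTensor.smul_tmul, smul_eq_mul, mul_one]
          rfl
        refine (congrArg (fun z => tensorUnitRight N (e (ModuleCat.of R R) z)) h1).trans ?_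
        exact (congrArg (tensorUnitRight N) this).trans (tensorUnitRight_tmul _ _) }
  refine ⟨φ, ?_⟩
  ext S ⟨x⟩
  refine ULift.ext _ _ ?_
  change e S x = BalancedTensor.map φ LinearMap.id x
  refine DFunLike.congr_fun (BalancedTensor.hom_ext fun m s => ?_) x
  have := key S (LinearMap.toSpanSingleton R S s) m
  rw [LinearMap.toSpanSingleton_apply, one_smul] at this
  exact this

variable (R) in
/-- The direct sum of countably many copies of `𝓡`, as a right `𝓡`-module. -/
abbrev natSum : FunctorOfModules Rᵐᵒᵖ :=
  ∐ fun _ : ℕ => quasiCoherentRight (ModuleCat.of R R)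

/-- The element of `(⨁_ℕ 𝓡)(N)` with the given coordinates. -/
def natSumMk (N : ModuleCat.{u} Rᵐᵒᵖ) : (ℕ →₀ N) →+ (natSum R).obj N :=
  Finsupp.liftAddHom fun i =>
    ((Sigma.ι (fun _ : ℕ => quasiCoherentRight (ModuleCat.of R R)) i).app N).hom.comp
      (AddEquiv.ulift.symm.toAddMonoidHom.comp ((BalancedTensor.mk (R := R)).flip (1 : R)))

theorem natSumMk_single (N : ModuleCat.{u} Rᵐᵒᵖ) (i : ℕ) (x : N) :
    natSumMk N (Finsupp.single i x) =
      (Sigma.ι (fun _ : ℕ => quasiCoherentRight (ModuleCat.of R R)) i).app N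
        (ULift.up (BalancedTensor.tmul R x (1 : R))) :=
  Finsupp.liftAddHom_apply_single _ _ _

theorem natSum_map_natSumMk {N N' : ModuleCat.{u} Rᵐᵒᵖ} (g : N →ₗ[Rᵐᵒᵖ] N') (n : ℕ →₀ N) :
    (natSum R).map (ModuleCat.ofHom g) (natSumMk N n) =
      natSumMk N' (n.mapRange g (map_zero g)) := by
  have : ((natSum R).map (ModuleCat.ofHom g)).hom.comp (natSumMk N) =
      (natSumMk N').comp (Finsupp.mapRange.addMonoidHom g.toAddMonoidHom) := by
    refine Finsupp.addHom_ext fun i x => ?_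
    rw [AddMonoidHom.comp_apply, AddMonoidHom.comp_apply, natSumMk_single,
      Finsupp.mapRange.addMonoidHom_apply, Finsupp.mapRange_single, natSumMk_single]
    exact (naturality_app (Sigma.ι (fun _ : ℕ => quasiCoherentRight (ModuleCat.of R R)) i)
      (ModuleCat.ofHom g) (ULift.up (BalancedTensor.tmul R x (1 : R)))).symm
  exact DFunLike.congr_fun this n

theorem natSumMk_surjective (N : ModuleCat.{u} Rᵐᵒᵖ) :
    Function.Surjective (natSumMk N : (ℕ →₀ N) →+ (natSum R).obj N) := by
  let q : (natSum R).obj N ⟶ AddCommGrpCat.of ((natSum R).obj N ⧸ (natSumMk N).range) :=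
    AddCommGrpCat.ofHom (QuotientAddGroup.mk' _)
  have hc := isColimitCofanMkObjOfIsColimit ((evaluation _ _).obj N) _ _
    (coproductIsCoproduct fun _ : ℕ => quasiCoherentRight (ModuleCat.of R R))
  -- The quotient by the range vanishes on every summand, hence on the coproduct.
  have hq : q = 0 := by
    refine Cofan.IsColimit.hom_ext hc _ _ fun i => ?_
    ext ⟨x⟩
    refine (QuotientAddGroup.eq_zero_iff _).2 ⟨Finsupp.single i (tensorUnitRight N x), ?_⟩
    rw [natSumMk_single, tensorUnitRight_tmul_one]
    rfl
  intro x
  exact (QuotientAddGroup.eq_zero_iff x).1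
    (congrArg (fun g : (natSum R).obj N ⟶ _ => g x) hq)

/-- The morphism `⨁_ℕ 𝓡 → 𝓦` given by a sequence in `W`. -/
def natSumDesc {W : ModuleCat.{u} R} (w : ℕ → W) : natSum R ⟶ quasiCoherentRight W :=
  Sigma.desc fun i => (tensorBifunctor R).flip.map
    (ModuleCat.ofHom (LinearMap.toSpanSingleton R W (w i)))

theorem app_natSumMk {W : ModuleCat.{u} R} (t : natSum R ⟶ quasiCoherentRight W) (w : ℕ → W)
    (h : ∀ (N : ModuleCat.{u} Rᵐᵒᵖ) (i : ℕ) (x : N),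
      (t.app N (natSumMk N (Finsupp.single i x)) : ULift (BalancedTensor R N W)).down =
        BalancedTensor.tmul R x (w i)) (N : ModuleCat.{u} Rᵐᵒᵖ) (n : ℕ →₀ N) :
    (t.app N (natSumMk N n) : ULift (BalancedTensor R N W)).down =
      n.sum fun i x => BalancedTensor.tmul R x (w i) := by
  have : (AddEquiv.ulift.toAddMonoidHom.comp (t.app N).hom).comp (natSumMk N) =
      Finsupp.liftAddHom fun i => (BalancedTensor.mk (R := R)).flip (w i) :=
    Finsupp.addHom_ext fun i x => (h N i x).trans (Finsupp.liftAddHom_apply_single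
      (fun i => (BalancedTensor.mk (R := R) (M := N)).flip (w i)) i x).symm
  exact DFunLike.congr_fun this n

theorem natSumDesc_natSumMk {W : ModuleCat.{u} R} (w : ℕ → W) (N : ModuleCat.{u} Rᵐᵒᵖ)
    (n : ℕ →₀ N) :
    ((natSumDesc w).app N (natSumMk N n) : ULift (BalancedTensor R N W)).down =
      n.sum fun i x => BalancedTensor.tmul R x (w i) := by
  refine app_natSumMk _ _ (fun N i x => ?_) N n
  rw [natSumMk_single]
  have hi : Sigma.ι (fun _ : ℕ => quasiCoherentRight (ModuleCat.of R R)) i ≫ natSumDesc w =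
      (tensorBifunctor R).flip.map (ModuleCat.ofHom (LinearMap.toSpanSingleton R W (w i))) :=
    Limits.Sigma.ι_desc _ i
  refine (congrArg (fun η : quasiCoherentRight (ModuleCat.of R R) ⟶ quasiCoherentRight W =>
    (η.app N (ULift.up (BalancedTensor.tmul R x (1 : R))) : ULift (BalancedTensor R N W)).down)
    hi).trans ?_
  change BalancedTensor.tmul R x ((1 : R) • w i) = _
  rw [one_smul]

/-- Yoneda for each summand: `x : N` is the image of `1` under `r ↦ x * r`, so the values of `t` at
the basis elements over `R` determine `t`. -/
theorem exists_sequence_of_natSum_hom {W : ModuleCat.{u} R}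
    (t : natSum R ⟶ quasiCoherentRight W) :
    ∃ w : ℕ → W, ∀ (N : ModuleCat.{u} Rᵐᵒᵖ) (n : ℕ →₀ N),
      (t.app N (natSumMk N n) : ULift (BalancedTensor R N W)).down =
        n.sum fun i x => BalancedTensor.tmul R x (w i) := by
  let v (i : ℕ) : BalancedTensor R R W := (t.app (ModuleCat.of Rᵐᵒᵖ R)
    (natSumMk (ModuleCat.of Rᵐᵒᵖ R) (Finsupp.single i (1 : R))) : ULift (BalancedTensor R R W)).down
  refine ⟨fun i => tensorUnitLeft W (v i), app_natSumMk t _ fun N i x => ?_⟩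
  let g : R →ₗ[Rᵐᵒᵖ] N :=
    { toFun := fun r => op r • x
      map_add' := fun r r' => by rw [← add_smul]; rfl
      map_smul' := fun a r => by simp [mul_smul] }
  have hg : Finsupp.single i x = (Finsupp.single i (1 : R)).mapRange g (map_zero g) := by
    rw [Finsupp.mapRange_single]
    simp [g]
  rw [hg]
  have h1 := natSum_map_natSumMk (N := ModuleCat.of Rᵐᵒᵖ R) g (Finsupp.single i (1 : R))
  have h2 := naturality_app t (ModuleCat.ofHom g)
    (natSumMk (ModuleCat.of Rᵐᵒᵖ R) (Finsupp.single i (1 : R)))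
  refine ((congrArg (fun z => (t.app N z : ULift (BalancedTensor R N W)).down) h1.symm).trans
    (congrArg ULift.down h2)).trans ?_
  change BalancedTensor.map g LinearMap.id (v i) = _
  conv_lhs => rw [← one_tmul_tensorUnitLeft (v i)]
  rw [BalancedTensor.map_tmul]
  simp [g]

theorem natSumMk_injective (N : ModuleCat.{u} Rᵐᵒᵖ) :
    Function.Injective (natSumMk N : (ℕ →₀ N) →+ (natSum R).obj N) := by
  refine (injective_iff_map_eq_zero _).2 fun n hn => ?_
  -- With no relations the presented module is free on `ℕ`, and `natSumDesc` into it detects all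
  -- coordinates of `n`.
  let c : Fin 0 → ℕ →₀ R := Fin.elim0
  have h := natSumDesc_natSumMk
    (W := ModuleCat.of R ((ℕ →₀ R) ⧸ Submodule.span R (Set.range c)))
    (fun i => (Submodule.span R (Set.range c)).mkQ (Finsupp.single i 1)) N n
  rw [hn, map_zero] at h
  obtain ⟨z, hz⟩ := (sum_tmul_eq_zero_iff_of_presentation c N n).1 h.symm
  exact Finsupp.ext fun i => by simp [hz]

/-- The element of the dual of `𝓜` given by a homomorphism out of `M`. -/
def dualMk {N : ModuleCat.{u} Rᵐᵒᵖ} (φ : M →ₗ[Rᵐᵒᵖ] N) : (dual (quasiCoherent M)).obj N :=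
  (tensorBifunctor R).map (ModuleCat.ofHom φ)

theorem dualMk_surjective {N : ModuleCat.{u} Rᵐᵒᵖ} (y : (dual (quasiCoherent M)).obj N) :
    ∃ φ : M →ₗ[Rᵐᵒᵖ] N, y = dualMk φ :=
  exists_eq_tensorBifunctor_map y

theorem exists_finsupp_of_dual_hom (f : dual (quasiCoherent M) ⟶ natSum R) :
    ∃ m : ℕ →₀ M, ∀ (N : ModuleCat.{u} Rᵐᵒᵖ) (φ : M →ₗ[Rᵐᵒᵖ] N),
      f.app N (dualMk φ) = natSumMk N (m.mapRange φ (map_zero φ)) := by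
  -- Yoneda: `𝓜^*` is represented by `M`, so `f` is determined by its value at the identity.
  obtain ⟨m, hm⟩ := natSumMk_surjective M (f.app M (dualMk LinearMap.id))
  refine ⟨m, fun N φ => ?_⟩
  rw [← natSum_map_natSumMk, hm, ← naturality_app]
  congr 1
  exact (Category.id_comp _).symm.trans (congrArg (· ≫ _) ((tensorBifunctor R).map_id M).symm)

/-- The morphism `𝓜^* → 𝓡` given by an element of `M`. -/
def dualEval (x : M) : dual (quasiCoherent M) ⟶ quasiCoherentRight (ModuleCat.of R R) where
  app N := AddCommGrpCat.ofHom (AddMonoidHom.mk'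
    (fun η : quasiCoherent M ⟶ quasiCoherent N =>
      η.app (ModuleCat.of R R) (ULift.up (BalancedTensor.tmul R x (1 : R))))
    fun _ _ => rfl)
  naturality _ _ _ := rfl

theorem exists_dual_hom_of_finsupp (m : ℕ →₀ M) :
    ∃ f : dual (quasiCoherent M) ⟶ natSum R,
      ∀ (N : ModuleCat.{u} Rᵐᵒᵖ) (φ : M →ₗ[Rᵐᵒᵖ] N),
        f.app N (dualMk φ) = natSumMk N (m.mapRange φ (map_zero φ)) := by
  induction m using Finsupp.induction_linear with
  | zero =>
    refine ⟨0, fun N φ => ?_⟩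
    rw [Finsupp.mapRange_zero, map_zero]
    rfl
  | add m m' h h' =>
    obtain ⟨f, hf⟩ := h
    obtain ⟨f', hf'⟩ := h'
    refine ⟨f + f', fun N φ => ?_⟩
    rw [Finsupp.mapRange_add (map_add φ), map_add, ← hf, ← hf']
    rfl
  | single i x =>
    refine ⟨dualEval x ≫ Sigma.ι (fun _ : ℕ => quasiCoherentRight (ModuleCat.of R R)) i,
      fun N φ => ?_⟩
    rw [Finsupp.mapRange_single, natSumMk_single]
    rfl

theorem homOrbitsAreAnnihilators_iff_cokernels :
    HomOrbitsAreAnnihilators M ↔ ∀ f : dual (quasiCoherent M) ⟶ natSum R,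
      ∃ (W : ModuleCat.{u} R) (i : cokernel f ⟶ quasiCoherentRight W), Mono i := by
  simp_rw [exists_mono_cokernel_iff]
  have hrange : ∀ (f : dual (quasiCoherent M) ⟶ natSum R) (m : ℕ →₀ M),
      (∀ (N : ModuleCat.{u} Rᵐᵒᵖ) (φ : M →ₗ[Rᵐᵒᵖ] N),
        f.app N (dualMk φ) = natSumMk N (m.mapRange φ (map_zero φ))) →
      ∀ (N : ModuleCat.{u} Rᵐᵒᵖ) (n : ℕ →₀ N),
        (∃ y, f.app N y = natSumMk N n) ↔ ∃ φ : M →ₗ[Rᵐᵒᵖ] N, ∀ i, φ (m i) = n i := by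
    refine fun f m hf N n => ⟨?_, ?_⟩
    · rintro ⟨y, hy⟩
      obtain ⟨φ, rfl⟩ := dualMk_surjective y
      rw [hf] at hy
      exact ⟨φ, fun i => DFunLike.congr_fun (natSumMk_injective N hy) i⟩
    · rintro ⟨φ, hφ⟩
      exact ⟨dualMk φ, (hf N φ).trans (congrArg _ (Finsupp.ext hφ))⟩
  constructor
  · intro h f
    obtain ⟨m, hf⟩ := exists_finsupp_of_dual_hom f
    obtain ⟨W, w, hw⟩ := h m
    refine ⟨W, natSumDesc w, fun N x => ?_⟩
    obtain ⟨n, rfl⟩ := natSumMk_surjective N x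
    rw [hrange f m hf, ← hw, ← natSumDesc_natSumMk]
    exact ⟨fun h => congrArg ULift.down h, fun h => ULift.ext _ _ h⟩
  · intro h m
    obtain ⟨f, hf⟩ := exists_dual_hom_of_finsupp m
    obtain ⟨W, t, ht⟩ := h f
    obtain ⟨w, hw⟩ := exists_sequence_of_natSum_hom t
    refine ⟨W, w, fun N n => ?_⟩
    rw [← hrange f m hf, ← ht, ← hw]
    exact ⟨fun h => ULift.ext _ _ h, fun h => congrArg ULift.down h⟩

end StrictMittagLefflerFunctors

end FunctorialModules

theorem mainTheorem5 (R : Type u) [Ring R] (M : ModuleCat.{u} Rᵐᵒᵖ) :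
    (FunctorialModules.IsMittagLeffler M ↔
      ∀ f : (∏ᶜ fun _ : ℕ => FunctorialModules.quasiCoherent (ModuleCat.of Rᵐᵒᵖ R)) ⟶
          FunctorialModules.quasiCoherent M,
        FunctorialModules.PreservesDirectProducts (kernel f)) ∧
    (FunctorialModules.IsStrictMittagLeffler M ↔
      ∀ f : FunctorialModules.dual (FunctorialModules.quasiCoherent M) ⟶
          ∐ fun _ : ℕ => FunctorialModules.quasiCoherentRight (ModuleCat.of R R),
        ∃ (N : ModuleCat.{u} R) (i : cokernel f ⟶ FunctorialModules.quasiCoherentRight N),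
          Mono i) :=
  ⟨FunctorialModules.isMittagLeffler_iff_tensorSeparatesProducts.trans
      FunctorialModules.tensorSeparatesProducts_iff_kernels,
    FunctorialModules.isStrictMittagLeffler_iff_homOrbitsAreAnnihilators.trans
      FunctorialModules.homOrbitsAreAnnihilators_iff_cokernels⟩
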